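/- **Setting.** Fix integers $K,n$, a compact set $\Theta\subset(\mathbb R^{n\times n}\times\mathbb R^n)^K$, a convex compact set $\Pi\subset\mathbb R^n$, and $\sigma_w>0$. A model consists of a parameter $\theta=(A_k,b_k)_{k=1}^K$, a $K\times K$ transition matrix $P=(p_{i,j})$, an initial distribution on $\{1,\dots,K\}$, and probability distributions $f_1,\dots,f_K$ on $\mathbb R^n$. The states $s_0,s_1,\dots$ form a Markov chain with this initial distribution and transition matrix $P$; the output at time $t\ge 1$ for input $x_t$ is $y_t=A_{s_t}x_t+b_{s_t}+w_t$, where, given the states, the $w_t$ are independent with $w_t\sim f_{s_t}$. The stage cost is minus the expected revenue, $$\mathcal J(i,x)=\mathbb E(-x\cdot y_t\mid s_{t-1}=i,\ x_t=x),$$ and its minimizer, the optimal input after state $i$, is $x_i^*=-\big(\sum_j p_{i,j}(A_j+A_j^{\mathsf T})\big)^{-1}\sum_j p_{i,j}b_j$. The model is admissible if $\theta\in\Theta$, every $A_k$ is negative definite (not necessarily symmetric), every $f_k$ has mean zero and coordinate variances at most $\sigma_w^2$, and $x_i^*\in\Pi$ for all $i$. **Policy.** MSPSA has parameters $\gamma_i,\gamma_i'>0$,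 integers $N_i,N_i'\ge0$, initial estimates $\hat x_{i,1}\in\Pi$, and a distribution $\nu$ on $\mathbb R$ that is symmetric around $0$ and satisfies $|\Delta|\le\xi_1$ almost surely and $\mathbb E(1/\Delta^2)\le\xi_2$ for $\Delta\sim\nu$, where $\xi_1,\xi_2>0$. For each $i$ and $k\ge1$ let $\Delta_{i,k}\in\mathbb R^n$ be random vectors, all of whose entries (over all $i,k$) are i.i.d. with law $\nu$ and independent of the states and the noise; let $\bar\Delta_{i,k}$ be the entrywise inverse of $\Delta_{i,k}$, and put $a_{i,k}=\gamma_i/(N_i+k)$, $c_{i,k}=\gamma_i'/(N_i'+k)^{1/4}$. At the $(2k-1)$-th time $t$ with $s_{t-1}=i$ the input is $x_t=\hat x_{i,k}+c_{i,k}\Delta_{i,k}$, and one stores $d^+_{i,k}=-x_t\cdot y_t$; at the $2k$-th such time the input is $x_t=\hat x_{i,k}-c_{i,k}\Delta_{i,k}$, with $d^-_{i,k}=-x_t\cdot y_t$, after which $\hat x_{i,k+1}$ is the Euclidean projection onto $\Pi$ of $$\hat x_{i,k}-a_{i,k}\,\frac{d^+_{i,k}-d^-_{i,k}}{c_{i,k}}\,\bar\Delta_{i,k}.$$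 **Theorem.** For every admissible model and every $T$, the cost difference $\sum_{t=1}^T\big(\mathcal J(s_{t-1},x_t)-\mathcal J(s_{t-1},x^*_{s_{t-1}})\big)$ of MSPSA is integrable. Moreover there are constants $C,C'>0$ (which may depend on $K,n,\Theta,\Pi,\sigma_w,\xi_1,\xi_2$ and the parameters of MSPSA, but not on $T$ or on the model) such that for all $T$ $$\sup\ \mathbb E\Big(\sum_{t=1}^T\|x_t-x^*_{s_{t-1}}\|_2^2\Big)\le C\sqrt T,\qquad \sup\ \mathbb E\Big(\sum_{t=1}^T\mathcal J(s_{t-1},x_t)-\sum_{t=1}^T\mathcal J(s_{t-1},x^*_{s_{t-1}})\Big)\le C'\sqrt T,$$ where both suprema are taken over all admissible models such that $$\gamma_i\ \ge\ \frac{1}{8\,\lambda_{\min}\!\big(-\sum_j p_{i,j}(A_j+A_j^{\mathsf T})/2\big)}\qquad\text{for every } i\in\{1,\dots,K\}.$$ -/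

import Mathlib

open MeasureTheory ProbabilityTheory
open scoped ENNReal

noncomputable section

/-- Prices and demands: `ℝⁿ` with the Euclidean norm. -/
abbrev Vec (n : ℕ) : Type := EuclideanSpace ℝ (Fin n)

/-- The system parameter `θ = (A_k, b_k)_{k = 1, …, K}` of a Markov jump affine model with equal
input and output dimension `n`. -/
abbrev Params (K n : ℕ) : Type := Fin K → Matrix (Fin n) (Fin n) ℝ × Vec n

/-- A model instance: the parameter `θ`, the transition matrix `P`, the law of the initial state
`s₀`, and the noise distributions `f_k`. -/
structure Model (K n : ℕ) where
  θ : Params K n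
  P : Matrix (Fin K) (Fin K) ℝ
  init : Fin K → ℝ
  f : Fin K → Measure (Vec n)

/-- Euclidean projection onto a set `D`: a point of `D` nearest to `x`. -/
def euclProj {n : ℕ} (D : Set (Vec n)) (x : Vec n) : Vec n :=
  open Classical in
  if h : ∃ y ∈ D, ∀ z ∈ D, ‖x - y‖ ≤ ‖x - z‖ then h.choose else x

/-- Minimum eigenvalue of a (symmetric) real matrix. -/
def minEigenvalue {n : ℕ} (M : Matrix (Fin n) (Fin n) ℝ) : ℝ :=
  sInf (spectrum ℝ M)

/-- Negative definiteness of a real matrix that need not be symmetric. -/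
def NegDefinite {n : ℕ} (A : Matrix (Fin n) (Fin n) ℝ) : Prop :=
  ∀ x : Vec n, x ≠ 0 → inner ℝ x (A.toEuclideanLin x) < 0

namespace Model

variable {K n : ℕ} (I : Model K n)

/-- The matrix `A_k`. -/
def A (k : Fin K) : Matrix (Fin n) (Fin n) ℝ := (I.θ k).1

/-- The vector `b_k`. -/
def b (k : Fin K) : Vec n := (I.θ k).2

/-- The output `y = A_k x + b_k + w` in state `k`, for input `x` and noise `w`. -/
def output (k : Fin K) (x w : Vec n) : Vec n :=
  (I.A k).toEuclideanLin x + I.b k + w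

/-- The stage cost `𝔼(- x ⬝ y_t | s_{t-1} = i, x_t = x)`: the next state `j` has probability
`p_{i,j}`, and given `j` the noise has law `f_j`. -/
def stageCost (i : Fin K) (x : Vec n) : ℝ :=
  ∑ j, I.P i j * ∫ w, -inner ℝ x (I.output j x w) ∂(I.f j)

/-- The optimal input `x_i^* = -(∑_j p_{i,j} (A_j + A_jᵀ))⁻¹ (∑_j p_{i,j} b_j)` after observing
state `i`. -/
def optInput (i : Fin K) : Vec n :=
  -((∑ j, I.P i j • (I.A j + (I.A j).transpose))⁻¹.toEuclideanLin (∑ j, I.P i j • I.b j))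

/-- The standing assumptions: `θ` lies in the set `Θ`, all `A_k` are negative definite, `P` is a
transition matrix, the noise is centred with coordinate variances at most `σw²`, and `D` contains
the optimal inputs. -/
structure Admissible (Θ : Set (Params K n)) (D : Set (Vec n)) (σw : ℝ) : Prop where
  θ_mem : I.θ ∈ Θ
  negDef : ∀ k, NegDefinite (I.A k)
  stochastic : I.P ∈ Matrix.rowStochastic ℝ (Fin K)
  init_mem : I.init ∈ stdSimplex ℝ (Fin K)
  noise_prob : ∀ k, IsProbabilityMeasure (I.f k)
  noise_memLp : ∀ k l, MemLp (fun w : Vec n => w l) 2 (I.f k)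
  noise_mean : ∀ k l, ∫ w, w l ∂(I.f k) = 0
  noise_var : ∀ k l, ∫ w, w l ^ 2 ∂(I.f k) ≤ σw ^ 2
  optInput_mem : ∀ i, I.optInput i ∈ D

end Model

/-- The parameters of the MSPSA policy: gain constants `γ_i, γ'_i, N_i, N'_i`, initial estimates
`x̂_{i,1}`, and the common distribution `ν` of the entries of the perturbation vectors. -/
structure MSPSA (K n : ℕ) where
  γ : Fin K → ℝ
  γ' : Fin K → ℝ
  N : Fin K → ℕ
  N' : Fin K → ℕ
  xInit : Fin K → Vec n
  ν : Measure ℝ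

/-- The memory of MSPSA: for every state `i`, the counter `t_i`, the flag `e_i`, the most recent
estimate of the optimal input, and the stored cost `d_i⁺`. -/
structure MSPSA.Memory (K n : ℕ) where
  count : Fin K → ℕ
  flag : Fin K → Bool
  est : Fin K → Vec n
  dPlus : Fin K → ℝ

namespace MSPSA

variable {K n : ℕ} (p : MSPSA K n)

/-- The requirements on the parameters of MSPSA. The expectation of `1 / Δ²` is taken in `[0, ∞]`
with `1 / 0 = ∞`. -/
structure Valid (D : Set (Vec n)) (ξ₁ ξ₂ : ℝ) : Prop where
  γ_pos : ∀ i, 0 < p.γ i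
  γ'_pos : ∀ i, 0 < p.γ' i
  xInit_mem : ∀ i, p.xInit i ∈ D
  ν_prob : IsProbabilityMeasure p.ν
  ν_symm : p.ν.map (fun x => -x) = p.ν
  ν_bdd : ∀ᵐ x ∂p.ν, |x| ≤ ξ₁
  ν_inv : ∫⁻ x, (ENNReal.ofReal (x ^ 2))⁻¹ ∂p.ν ≤ ENNReal.ofReal ξ₂

/-- The step size `a_k = γ_i / (N_i + k)`. -/
def stepGain (i : Fin K) (k : ℕ) : ℝ := p.γ i / ((p.N i : ℝ) + k)

/-- The perturbation gain `c_k = γ'_i / (N'_i + k)^{1/4}`. -/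
def pertGain (i : Fin K) (k : ℕ) : ℝ := p.γ' i / ((p.N' i : ℝ) + k) ^ (1 / 4 : ℝ)

/-- The memory before the first stage. -/
def initMemory : Memory K n where
  count := fun _ => 0
  flag := fun _ => false
  est := p.xInit
  dPlus := fun _ => 0

/-- The input chosen after observing state `i`; `δ i k` is the `k`-th perturbation vector drawn
for state `i`. -/
def input (m : Memory K n) (δ : Fin K → ℕ → Vec n) (i : Fin K) : Vec n :=
  if m.flag i then m.est i - p.pertGain i (m.count i) • δ i (m.count i)
  else m.est i + p.pertGain i (m.count i + 1) • δ i (m.count i + 1)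

/-- The memory after a stage in which the previous state was `i` and the output was `y`. -/
def update (D : Set (Vec n)) (m : Memory K n) (δ : Fin K → ℕ → Vec n) (i : Fin K) (y : Vec n) :
    Memory K n :=
  let x := p.input m δ i
  if m.flag i then
    let k := m.count i
    let dMinus : ℝ := -inner ℝ x y
    let δInv : Vec n := WithLp.toLp 2 fun l => 1 / δ i k l
    { m with
      flag := Function.update m.flag i false
      est := Function.update m.est i
        (euclProj D
          (m.est i - (p.stepGain i k * ((m.dPlus i - dMinus) / p.pertGain i k)) • δInv)) }
  else
    { m with
      count := Function.update m.count i (m.count i + 1)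
      flag := Function.update m.flag i true
      dPlus := Function.update m.dPlus i (-inner ℝ x y) }

/-- The memory after `t` stages, along the state sequence `s`, noise sequence `w` and perturbation
vectors `δ`. Stage `t + 1` observes `s t`, chooses the input, and then sees the output in state
`s (t + 1)` with noise `w (t + 1)`. -/
def memory (D : Set (Vec n)) (I : Model K n) (s : ℕ → Fin K) (w : ℕ → Vec n)
    (δ : Fin K → ℕ → Vec n) : ℕ → Memory K n
  | 0 => p.initMemory
  | t + 1 =>
    let m := memory D I s w δ t
    p.update D m δ (s t) (I.output (s (t + 1)) (p.input m δ (s t)) (w (t + 1)))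

end MSPSA

/-- A probability space carrying the states `s₀, s₁, …`, the noise `w₁, w₂, …` and the
perturbation vectors. The states form a Markov chain with initial law `init` and transition matrix
`P`; given the states, the `w_t` are independent with laws `f_{s_t}`; the entries of the
perturbation vectors are i.i.d. with law `ν` and independent of the states and the noise. The
variable `w 0` plays no role. -/
structure Realization {K n : ℕ} (I : Model K n) (ν : Measure ℝ) where
  Ω : Type
  [mΩ : MeasurableSpace Ω]
  μ : Measure Ω
  prob : IsProbabilityMeasure μ
  s : ℕ → Ω → Fin K
  w : ℕ → Ω → Vec n
  δ : Fin K → ℕ → Ω → Vec n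
  meas_s : ∀ t, Measurable (s t)
  meas_w : ∀ t, Measurable (w t)
  meas_δ : ∀ i k, Measurable (δ i k)
  law : ∀ (T : ℕ) (j : ℕ → Fin K) (B : ℕ → Set (Vec n)), (∀ t, MeasurableSet (B t)) →
    μ ({ω | ∀ t ≤ T, s t ω = j t} ∩ {ω | ∀ t < T, w (t + 1) ω ∈ B (t + 1)}) =
      ENNReal.ofReal (I.init (j 0)) *
        ∏ t ∈ Finset.range T,
          (ENNReal.ofReal (I.P (j t) (j (t + 1))) * I.f (j (t + 1)) (B (t + 1)))
  δ_law : ∀ i k l, μ.map (fun ω => δ i k ω l) = ν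
  δ_indep : iIndepFun (fun (q : Fin K × ℕ × Fin n) ω => δ q.1 q.2.1 ω q.2.2) μ
  δ_indep_system :
    IndepFun (fun ω (i : Fin K) (k : ℕ) => δ i k ω) (fun ω => (fun t => s t ω, fun t => w t ω)) μ

attribute [instance] Realization.mΩ

namespace Realization

variable {K n : ℕ} {I : Model K n}

/-- The MSPSA input `x_{t+1}`, which is chosen after observing `s_t`. -/
def input {p : MSPSA K n} (R : Realization I p.ν) (D : Set (Vec n)) (t : ℕ) (ω : R.Ω) : Vec n :=
  p.input
    (p.memory D I (fun r => R.s r ω) (fun r => R.w r ω) (fun i k => R.δ i k ω) t)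
    (fun i k => R.δ i k ω) (R.s t ω)

/-- The cumulative input-MSE `𝔼 ∑_{t=1}^T ‖x_t - x^*_{s_{t-1}}‖²` of MSPSA, in `[0, ∞]`. -/
def inputMSE {p : MSPSA K n} (R : Realization I p.ν) (D : Set (Vec n)) (T : ℕ) : ℝ≥0∞ :=
  ∫⁻ ω, ∑ t ∈ Finset.range T, ‖R.input D t ω - I.optInput (R.s t ω)‖ₑ ^ 2 ∂(R.μ)

/-- The realized cost difference `∑_{t=1}^T J(s_{t-1}, x_t) - ∑_{t=1}^T J(s_{t-1}, x_t^*)`. -/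
def costGap {p : MSPSA K n} (R : Realization I p.ν) (D : Set (Vec n)) (T : ℕ) (ω : R.Ω) : ℝ :=
  ∑ t ∈ Finset.range T, I.stageCost (R.s t ω) (R.input D t ω) -
    ∑ t ∈ Finset.range T, I.stageCost (R.s t ω) (I.optInput (R.s t ω))

/-- The cumulative regret of MSPSA over the horizon `T`. -/
def regret {p : MSPSA K n} (R : Realization I p.ν) (D : Set (Vec n)) (T : ℕ) : ℝ :=
  ∫ ω, R.costGap D T ω ∂(R.μ)

end Realization

namespace MSPSA

variable {K n : ℕ} (p : MSPSA K n)

/-- The step size condition `γ_i ≥ 1 / (8 λ_min(-∑_j p_{i,j} (A_j + A_jᵀ) / 2))` for all `i`. -/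
def StepCondition (I : Model K n) : Prop :=
  ∀ i, 1 / (8 * minEigenvalue
    (-∑ j, I.P i j • ((1 / 2 : ℝ) • (I.A j + (I.A j).transpose)))) ≤ p.γ i

/-- The worst-case cumulative input-MSE of MSPSA over a class `𝒞` of models. -/
def worstInputMSE (D : Set (Vec n)) (𝒞 : Set (Model K n)) (T : ℕ) : ℝ≥0∞ :=
  ⨆ I ∈ 𝒞, ⨆ R : Realization I p.ν, R.inputMSE D T

/-- The worst-case regret of MSPSA over a class `𝒞` of models. -/
def worstRegret (D : Set (Vec n)) (𝒞 : Set (Model K n)) (T : ℕ) : EReal :=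
  ⨆ I ∈ 𝒞, ⨆ R : Realization I p.ν, ((R.regret D T : ℝ) : EReal)

end MSPSA

end

noncomputable section

/-! The stage cost after state `i` is a quadratic with Hessian `I.hess i` and minimizer `I.optInput
i`. A symmetric difference of a quadratic is exactly linear in the probing direction
(`stageCost_add_sub_sub`), and the entries of a perturbation vector `v` satisfy `E (v m / v l) = 1`
if `l = m` and `0` otherwise. One MSPSA update is therefore an unbiased gradient step, followed by a
projection that does not increase the distance to the optimum. The condition on `γ i` makes the
drift strong enough that the mean square error of the estimate is multiplied by at most `1 - 1/(N +
k)`, up to an additive term of order `(a_k / c_k)² ~ k^(-3/2)` (`lintegral_newEst_le`). This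
recursion is solved by `B / √k` (`one_sub_mul_div_sqrt_add_le`). The probing itself costs `c_k² ~
k^(-1/2)` per visit, so both contributions add up to order `√T`.

The difficulty is that updates happen at random visit times, and the next visit to `i` depends on
the very transition whose output was observed. Instead of stopping times, the proof uses a
`potential` for each state, a function of the memory that dominates the expected cost of the
remaining visits. A stage changes only the potential of the visited state, and its expected decrease
pays for the current squared input error (`lintegral_cost_add_potentialAfter_le`). Telescoping
bounds the total error by the initial potential (`inputMSE_le_potential`). The weights of the
potential solve the adjoint of the error recursion backwards from the horizon (`exists_weights`),
which makes the initial potential at most the sum of the deterministic bounds over `T` pairs of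
visits.

Two probabilistic facts drive the decrease. Given the past and all perturbation vectors, the next
state and noise have law `I.next (s t)` (`lintegral_next`). A perturbation vector that has not been
used may be replaced by an independent copy (`setLIntegral_pairErr`), because the memory does not
depend on it (`memory_congr`). Regret follows since the excess cost is at most `M` times the squared
input error, with `M` uniform over the compact parameter set. -/

/-! ### Projection onto a compact convex set. -/

theorem exists_euclProj_eq {n : ℕ} {D : Set (Vec n)} (hD : IsCompact D) (hne : D.Nonempty)
    (x : Vec n) : euclProj D x ∈ D ∧ ∀ z ∈ D, ‖x - euclProj D x‖ ≤ ‖x - z‖ := by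
  have h : ∃ y ∈ D, ∀ z ∈ D, ‖x - y‖ ≤ ‖x - z‖ := by
    obtain ⟨y, hy, h⟩ := hD.exists_isMinOn hne (f := fun y => ‖x - y‖) (by fun_prop)
    exact ⟨y, hy, fun z hz => h hz⟩
  unfold euclProj
  rw [dif_pos h]
  exact h.choose_spec

theorem inner_sub_euclProj_nonpos {n : ℕ} {D : Set (Vec n)} (hD : IsCompact D)
    (hconv : Convex ℝ D) (x : Vec n) {z : Vec n} (hz : z ∈ D) :
    inner ℝ (x - euclProj D x) (z - euclProj D x) ≤ 0 := by
  obtain ⟨h1, h2⟩ := exists_euclProj_eq hD ⟨z, hz⟩ x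
  refine (norm_eq_iInf_iff_real_inner_le_zero hconv h1).1 ?_ z hz
  have : Nonempty D := ⟨⟨z, hz⟩⟩
  refine le_antisymm (le_ciInf fun w => h2 w w.2) ?_
  exact ciInf_le ⟨0, by rintro _ ⟨w, rfl⟩; positivity⟩ (⟨_, h1⟩ : D)

/-- Adding the variational inequalities at the two projections gives `‖u - v‖² ≤ ⟪x - y, u - v⟫`,
and Cauchy–Schwarz finishes. -/
theorem norm_euclProj_sub_euclProj_le {n : ℕ} {D : Set (Vec n)} (hD : IsCompact D)
    (hconv : Convex ℝ D) (hne : D.Nonempty) (x y : Vec n) :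
    ‖euclProj D x - euclProj D y‖ ≤ ‖x - y‖ := by
  have hx := inner_sub_euclProj_nonpos hD hconv x (exists_euclProj_eq hD hne y).1
  have hy := inner_sub_euclProj_nonpos hD hconv y (exists_euclProj_eq hD hne x).1
  set u := euclProj D x
  set v := euclProj D y
  have key : ‖u - v‖ ^ 2 ≤ ‖x - y‖ * ‖u - v‖ := by
    refine le_trans ?_ (real_inner_le_norm (x - y) (u - v))
    rw [← real_inner_self_eq_norm_sq]
    simp only [inner_sub_left, inner_sub_right] at *
    linarith
  rcases (norm_nonneg (u - v)).eq_or_lt with h | h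
  · rw [← h]; positivity
  · nlinarith

theorem continuous_euclProj {n : ℕ} {D : Set (Vec n)} (hD : IsCompact D)
    (hconv : Convex ℝ D) (hne : D.Nonempty) : Continuous (euclProj D) := by
  refine (LipschitzWith.of_dist_le_mul (K := 1) fun x y => ?_).continuous
  simpa [dist_eq_norm] using norm_euclProj_sub_euclProj_le hD hconv hne x y

theorem euclProj_of_mem {n : ℕ} {D : Set (Vec n)} (hD : IsCompact D) {z : Vec n} (hz : z ∈ D) :
    euclProj D z = z := by
  have h := (exists_euclProj_eq hD ⟨z, hz⟩ z).2 z hz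
  simp only [sub_self, norm_zero, norm_le_zero_iff] at h
  exact (sub_eq_zero.1 h).symm

theorem norm_euclProj_sub_le {n : ℕ} {D : Set (Vec n)} (hD : IsCompact D)
    (hconv : Convex ℝ D) (x : Vec n) {z : Vec n} (hz : z ∈ D) :
    ‖euclProj D x - z‖ ≤ ‖x - z‖ := by
  simpa [euclProj_of_mem hD hz] using norm_euclProj_sub_euclProj_le hD hconv ⟨z, hz⟩ x z

/-! ### Quadratic forms and the smallest eigenvalue. -/

theorem inner_toEuclideanLin_eq {n : ℕ} (S : Matrix (Fin n) (Fin n) ℝ) (x y : Vec n) :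
    inner ℝ x (S.toEuclideanLin y) = x.ofLp ⬝ᵥ S.mulVec y.ofLp := by
  rw [← Matrix.inner_toEuclideanCLM]; rfl

theorem inner_toEuclideanLin_transpose {n : ℕ} (S : Matrix (Fin n) (Fin n) ℝ) (x y : Vec n) :
    inner ℝ x (S.transpose.toEuclideanLin y) = inner ℝ y (S.toEuclideanLin x) := by
  rw [inner_toEuclideanLin_eq, inner_toEuclideanLin_eq, Matrix.dotProduct_mulVec,
    Matrix.vecMul_transpose, dotProduct_comm]

/-- Subtracting the infimum of the finite spectrum leaves a symmetric matrix with nonnegative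
eigenvalues, hence a positive semidefinite one. -/
theorem minEigenvalue_mul_norm_sq_le {n : ℕ} {S : Matrix (Fin n) (Fin n) ℝ}
    (hS : S.IsHermitian) (x : Vec n) :
    minEigenvalue S * ‖x‖ ^ 2 ≤ inner ℝ x (S.toEuclideanLin x) := by
  set l := minEigenvalue S with hl
  have hfin : (spectrum ℝ S).Finite := by
    rw [hS.spectrum_real_eq_range_eigenvalues]; exact Set.finite_range _
  have hH : (S - algebraMap ℝ _ l).IsHermitian := by
    refine hS.sub ?_
    rw [Matrix.IsHermitian, Matrix.algebraMap_eq_diagonal, Matrix.diagonal_conjTranspose]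
    congr 1
  have hpos : (S - algebraMap ℝ _ l).PosSemidef := by
    rw [hH.posSemidef_iff_eigenvalues_nonneg]
    intro i
    have h := hH.eigenvalues_mem_spectrum_real i
    rw [← spectrum.sub_singleton_eq] at h
    obtain ⟨a, ha, b, rfl, h⟩ := h
    have : l ≤ a := csInf_le hfin.bddBelow ha
    simp only [Pi.zero_apply]
    rw [← h]
    simpa using this
  have h := hpos.dotProduct_mulVec_nonneg x.ofLp
  rw [Matrix.sub_mulVec, dotProduct_sub, Matrix.algebraMap_eq_diagonal] at h
  rw [inner_toEuclideanLin_eq, ← real_inner_self_eq_norm_sq]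
  have e : inner ℝ x x = x.ofLp ⬝ᵥ x.ofLp := by
    rw [real_inner_self_eq_norm_sq, EuclideanSpace.real_norm_sq_eq]; simp [dotProduct, sq]
  have e2 : (Matrix.diagonal (algebraMap ℝ (Fin n → ℝ) l)).mulVec x.ofLp = l • x.ofLp := by
    ext i; simp [Matrix.mulVec_diagonal]
  rw [e2, dotProduct_smul] at h
  rw [e]
  simpa using h

theorem minEigenvalue_pos {n : ℕ} (hn : 0 < n) {S : Matrix (Fin n) (Fin n) ℝ}
    (hS : S.PosDef) : 0 < minEigenvalue S := by
  have : Nonempty (Fin n) := ⟨⟨0, hn⟩⟩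
  have hmem : minEigenvalue S ∈ spectrum ℝ S := by
    have hr := hS.1.spectrum_real_eq_range_eigenvalues
    refine Set.Nonempty.csInf_mem ?_ ?_
    · rw [hr]; exact Set.range_nonempty _
    · rw [hr]; exact Set.finite_range _
  rw [hS.1.spectrum_real_eq_range_eigenvalues] at hmem
  obtain ⟨i, hi⟩ := hmem
  rw [← hi]
  exact hS.eigenvalues_pos i

/-! ### The Hessian of the stage cost and the step size condition. -/

namespace Model

variable {K n : ℕ} (I : Model K n)

/-- The Hessian `-∑_j p_{i,j} (A_j + A_jᵀ)` of the stage cost after state `i`. -/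
def hess (i : Fin K) : Matrix (Fin n) (Fin n) ℝ :=
  -∑ j, I.P i j • (I.A j + (I.A j).transpose)

/-- The mean intercept `∑_j p_{i,j} b_j`. -/
def meanB (i : Fin K) : Vec n := ∑ j, I.P i j • I.b j

theorem inner_hess (i : Fin K) (x y : Vec n) :
    inner ℝ x ((I.hess i).toEuclideanLin y) =
      -∑ j, I.P i j * (inner ℝ x ((I.A j).toEuclideanLin y) +
        inner ℝ y ((I.A j).toEuclideanLin x)) := by
  simp only [hess, map_neg, map_sum, map_smul, map_add, LinearMap.neg_apply, LinearMap.sum_apply,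
    LinearMap.smul_apply, LinearMap.add_apply, inner_neg_right, inner_sum, inner_smul_right,
    inner_add_right, inner_toEuclideanLin_transpose]

theorem inner_hess_comm (i : Fin K) (x y : Vec n) :
    inner ℝ x ((I.hess i).toEuclideanLin y) = inner ℝ y ((I.hess i).toEuclideanLin x) := by
  rw [inner_hess, inner_hess]
  simp only [add_comm]

theorem isHermitian_hess (i : Fin K) : (I.hess i).IsHermitian := by
  rw [Matrix.IsHermitian, Matrix.conjTranspose_eq_transpose_of_trivial]
  simp only [hess, Matrix.transpose_neg, Matrix.transpose_sum, Matrix.transpose_smul,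
    Matrix.transpose_add, Matrix.transpose_transpose, add_comm]

variable {I} {Θ : Set (Params K n)} {D : Set (Vec n)} {σw : ℝ}

theorem Admissible.P_nonneg (h : I.Admissible Θ D σw) (i j : Fin K) : 0 ≤ I.P i j :=
  h.stochastic.1 i j

theorem Admissible.P_sum (h : I.Admissible Θ D σw) (i : Fin K) : ∑ j, I.P i j = 1 :=
  (Matrix.mem_rowStochastic_iff_sum.1 h.stochastic).2 i

theorem Admissible.posDef_hess (h : I.Admissible Θ D σw) (i : Fin K) : (I.hess i).PosDef := by
  refine Matrix.PosDef.of_dotProduct_mulVec_pos (I.isHermitian_hess i) fun x hx => ?_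
  have hx' : (WithLp.toLp 2 x : Vec n) ≠ 0 := by
    intro h0; apply hx; simpa using congrArg WithLp.ofLp h0
  have e := I.inner_hess i (WithLp.toLp 2 x) (WithLp.toLp 2 x)
  rw [inner_toEuclideanLin_eq] at e
  simp only [star_trivial]
  rw [e, neg_pos]
  obtain ⟨j, hj⟩ : ∃ j, 0 < I.P i j := by
    by_contra! hc
    have := h.P_sum i
    have h2 := Finset.sum_nonpos fun j (_ : j ∈ Finset.univ) => hc j
    linarith
  have hneg := fun j => h.negDef j _ hx'
  refine Finset.sum_neg' (fun j _ => ?_) ⟨j, Finset.mem_univ _, ?_⟩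
  · exact mul_nonpos_of_nonneg_of_nonpos (h.P_nonneg i j) (by linarith [hneg j])
  · exact mul_neg_of_pos_of_neg hj (by linarith [hneg j])

theorem Admissible.hess_optInput (h : I.Admissible Θ D σw) (i : Fin K) :
    (I.hess i).toEuclideanLin (I.optInput i) = I.meanB i := by
  have hu : IsUnit (I.hess i) := (h.posDef_hess i).isUnit
  set N := ∑ j, I.P i j • (I.A j + (I.A j).transpose) with hN
  have hN' : I.hess i = -N := rfl
  have hdet : IsUnit N.det := by
    rw [← Matrix.isUnit_iff_isUnit_det]
    rw [hN'] at hu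
    simpa using hu
  have : N.toEuclideanLin (N⁻¹.toEuclideanLin (I.meanB i)) = I.meanB i := by
    rw [Matrix.toLpLin_apply, Matrix.toLpLin_apply, Matrix.mulVec_mulVec,
      Matrix.mul_nonsing_inv _ hdet, Matrix.one_mulVec]
  rw [hN', optInput, map_neg, map_neg, LinearMap.neg_apply, neg_neg]
  exact this

/-- The step condition concerns the smallest eigenvalue `λ` of half the Hessian: the quadratic form
is at least `2 λ ‖x‖²`, and `8 λ γ ≥ 1`. This is the form in which the condition enters the
contraction. -/
theorem Admissible.le_inner_hess (h : I.Admissible Θ D σw) {p : MSPSA K n}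
    (hγ : ∀ i, 0 < p.γ i) (hstep : p.StepCondition I) (i : Fin K) (x : Vec n) :
    ‖x‖ ^ 2 ≤ 4 * p.γ i * inner ℝ x ((I.hess i).toEuclideanLin x) := by
  -- In dimension zero the spectrum is empty and `minEigenvalue` is not positive, so this case is
  -- separate.
  rcases Nat.eq_zero_or_pos n with hn | hn
  · subst hn
    have : x = 0 := Subsingleton.elim _ _
    simp [this]
  have e : (-∑ j, I.P i j • ((1 / 2 : ℝ) • (I.A j + (I.A j).transpose))) =
      (1 / 2 : ℝ) • I.hess i := by
    simp only [hess, smul_neg, Finset.smul_sum]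
    congr 1
    refine Finset.sum_congr rfl fun j _ => ?_
    rw [smul_comm]
  have hs := hstep i
  rw [e] at hs
  have hpd : ((1 / 2 : ℝ) • I.hess i).PosDef := (h.posDef_hess i).smul (by norm_num)
  have hpos := minEigenvalue_pos hn hpd
  have hle := minEigenvalue_mul_norm_sq_le hpd.1 x
  rw [map_smul, LinearMap.smul_apply, inner_smul_right] at hle
  rw [div_le_iff₀ (by positivity)] at hs
  have := hγ i
  nlinarith [sq_nonneg ‖x‖, mul_le_mul_of_nonneg_left hle this.le,
    mul_le_mul_of_nonneg_right hs (sq_nonneg ‖x‖)]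

end Model

/-! ### The law of one transition and the stage cost as a quadratic. -/

namespace Model

variable {K n : ℕ} (I : Model K n)

/-- The joint law of the next state and the noise, given that the current state is `i`. -/
def next (i : Fin K) : Measure (Fin K × Vec n) :=
  ∑ j, ENNReal.ofReal (I.P i j) • (I.f j).map (Prod.mk j)

/-- The observed cost `-x ⬝ y` for input `x` when the next state and the noise are `z`. -/
def obsCost (x : Vec n) (z : Fin K × Vec n) : ℝ := -inner ℝ x (I.output z.1 x z.2)

theorem measurable_output : Measurable fun q : Fin K × Vec n × Vec n => I.output q.1 q.2.1 q.2.2 := by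
  refine measurable_from_prod_countable_right fun j => ?_
  have hA : Measurable fun x : Vec n => (I.A j).toEuclideanLin x :=
    (LinearMap.continuous_of_finiteDimensional _).measurable
  have h : Measurable fun q : Vec n × Vec n => (I.A j).toEuclideanLin q.1 + I.b j + q.2 :=
    ((hA.comp measurable_fst).add measurable_const).add measurable_snd
  exact h

theorem measurable_obsCost : Measurable fun q : Vec n × (Fin K × Vec n) => I.obsCost q.1 q.2 := by
  unfold obsCost
  have h := I.measurable_output.comp
    (f := fun q : Vec n × (Fin K × Vec n) => (q.2.1, q.1, q.2.2)) (by fun_prop)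
  exact (measurable_fst.inner h).neg

theorem next_apply (i : Fin K) {V : Set (Fin K × Vec n)} (hV : MeasurableSet V) :
    I.next i V = ∑ j, ENNReal.ofReal (I.P i j) * I.f j (Prod.mk j ⁻¹' V) := by
  simp only [next, Measure.coe_finsetSum, Finset.sum_apply, Measure.smul_apply, smul_eq_mul]
  refine Finset.sum_congr rfl fun j _ => ?_
  rw [Measure.map_apply measurable_prodMk_left hV]

theorem measurableEmbedding_prodMk (j : Fin K) :
    MeasurableEmbedding (Prod.mk j : Vec n → Fin K × Vec n) :=
  MeasurableEmbedding.prodMk_left j MeasurableEmbedding.id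

theorem integrable_next {F : Fin K × Vec n → ℝ} (i : Fin K)
    (hF : ∀ j, Integrable (fun w => F (j, w)) (I.f j)) : Integrable F (I.next i) := by
  unfold next
  rw [integrable_finsetSum_measure]
  intro j _
  refine Integrable.smul_measure ?_ ENNReal.ofReal_ne_top
  rw [(measurableEmbedding_prodMk j).integrable_map_iff]
  exact hF j

theorem integral_next (hP : ∀ i j, 0 ≤ I.P i j) {F : Fin K × Vec n → ℝ} (i : Fin K)
    (hF : ∀ j, Integrable (fun w => F (j, w)) (I.f j)) :
    ∫ z, F z ∂(I.next i) = ∑ j, I.P i j * ∫ w, F (j, w) ∂(I.f j) := by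
  unfold next
  rw [integral_finsetSum_measure]
  · refine Finset.sum_congr rfl fun j _ => ?_
    rw [integral_smul_measure, (measurableEmbedding_prodMk j).integral_map,
      ENNReal.toReal_ofReal (hP i j), smul_eq_mul]
  · intro j _
    refine Integrable.smul_measure ?_ ENNReal.ofReal_ne_top
    rw [(measurableEmbedding_prodMk j).integrable_map_iff]
    exact hF j

variable {I} {Θ : Set (Params K n)} {D : Set (Vec n)} {σw : ℝ}

theorem Admissible.isProbabilityMeasure_next (h : I.Admissible Θ D σw) (i : Fin K) :
    IsProbabilityMeasure (I.next i) := by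
  constructor
  rw [I.next_apply i MeasurableSet.univ]
  have : ∀ j, I.f j Set.univ = 1 := fun j => (h.noise_prob j).measure_univ
  simp only [Set.preimage_univ, this, mul_one]
  rw [← ENNReal.ofReal_sum_of_nonneg fun j _ => h.P_nonneg i j, h.P_sum, ENNReal.ofReal_one]

theorem Admissible.memLp_noise (h : I.Admissible Θ D σw) (k : Fin K) :
    MemLp (fun w : Vec n => w) 2 (I.f k) := by
  have := h.noise_prob k
  exact MemLp.of_eval_piLp fun l => h.noise_memLp k l

theorem Admissible.memLp_inner_noise (h : I.Admissible Θ D σw) (k : Fin K) (x : Vec n) :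
    MemLp (fun w : Vec n => inner ℝ x w) 2 (I.f k) :=
  (h.memLp_noise k).const_inner x

theorem Admissible.integral_inner_noise (h : I.Admissible Θ D σw) (k : Fin K) (x : Vec n) :
    ∫ w, inner ℝ x w ∂(I.f k) = 0 := by
  have := h.noise_prob k
  rw [integral_inner ((h.memLp_noise k).integrable one_le_two)]
  have : ∫ w, w ∂(I.f k) = 0 := by
    ext l
    rw [eval_integral_piLp fun l => (h.noise_memLp k l).integrable one_le_two]
    exact h.noise_mean k l
  rw [this, inner_zero_right]

theorem Admissible.integral_norm_sq_noise_le (h : I.Admissible Θ D σw) (k : Fin K) :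
    ∫ w, ‖w‖ ^ 2 ∂(I.f k) ≤ n * σw ^ 2 := by
  simp only [EuclideanSpace.real_norm_sq_eq]
  rw [integral_finsetSum _ fun l _ => (h.noise_memLp k l).integrable_sq]
  refine (Finset.sum_le_sum fun l _ => h.noise_var k l).trans ?_
  simp

theorem obsCost_eq (x : Vec n) (j : Fin K) (w : Vec n) :
    I.obsCost x (j, w) =
      -(inner ℝ x ((I.A j).toEuclideanLin x) + inner ℝ x (I.b j)) - inner ℝ x w := by
  simp only [obsCost, output, inner_add_right]
  ring

theorem Admissible.memLp_obsCost (h : I.Admissible Θ D σw) (x : Vec n) (j : Fin K) :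
    MemLp (fun w => I.obsCost x (j, w)) 2 (I.f j) := by
  have := h.noise_prob j
  simp only [obsCost_eq]
  exact (memLp_const _).sub (h.memLp_inner_noise j x)

theorem Admissible.integral_obsCost (h : I.Admissible Θ D σw) (x : Vec n) (j : Fin K) :
    ∫ w, I.obsCost x (j, w) ∂(I.f j) =
      -(inner ℝ x ((I.A j).toEuclideanLin x) + inner ℝ x (I.b j)) := by
  have := h.noise_prob j
  simp only [obsCost_eq]
  rw [integral_sub (integrable_const _) ((h.memLp_inner_noise j x).integrable one_le_two),
    h.integral_inner_noise]
  simp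

theorem Admissible.integral_next_obsCost (h : I.Admissible Θ D σw) (x : Vec n) (i : Fin K) :
    ∫ z, I.obsCost x z ∂(I.next i) = I.stageCost i x := by
  rw [I.integral_next h.P_nonneg i fun j => by
    have := h.noise_prob j
    exact (h.memLp_obsCost x j).integrable one_le_two]
  rfl

theorem Admissible.stageCost_eq (h : I.Admissible Θ D σw) (i : Fin K) (x : Vec n) :
    I.stageCost i x =
      1 / 2 * inner ℝ x ((I.hess i).toEuclideanLin x) - inner ℝ x (I.meanB i) := by
  have e : I.stageCost i x = ∑ j, I.P i j * ∫ w, I.obsCost x (j, w) ∂(I.f j) := rfl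
  rw [e, inner_hess, meanB, inner_sum, mul_neg, Finset.mul_sum, ← Finset.sum_neg_distrib,
    ← Finset.sum_sub_distrib]
  refine Finset.sum_congr rfl fun j _ => ?_
  rw [h.integral_obsCost, inner_smul_right]
  ring

theorem Admissible.stageCost_sub_optInput (h : I.Admissible Θ D σw) (i : Fin K) (x : Vec n) :
    I.stageCost i x - I.stageCost i (I.optInput i) =
      1 / 2 * inner ℝ (x - I.optInput i) ((I.hess i).toEuclideanLin (x - I.optInput i)) := by
  rw [h.stageCost_eq, h.stageCost_eq, ← h.hess_optInput]
  simp only [map_sub, inner_sub_left, inner_sub_right]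
  rw [I.inner_hess_comm i (I.optInput i) x]
  ring

/-- Even-order terms cancel in the symmetric difference, and a quadratic has no cubic term. The
finite difference thus has no bias in `c`, and only its variance limits the rate. -/
theorem Admissible.stageCost_add_sub_sub (h : I.Admissible Θ D σw) (i : Fin K) (x v : Vec n)
    (c : ℝ) :
    I.stageCost i (x + c • v) - I.stageCost i (x - c • v) =
      2 * c * inner ℝ v ((I.hess i).toEuclideanLin (x - I.optInput i)) := by
  rw [h.stageCost_eq, h.stageCost_eq, ← h.hess_optInput]
  simp only [map_sub, map_add, map_smul, inner_sub_left, inner_sub_right, inner_add_left,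
    inner_add_right, real_inner_smul_left, real_inner_smul_right]
  rw [I.inner_hess_comm i x v]
  ring

/-- This variance bound depends on the model only through `M` and `σw`, which is what makes the
final constants uniform. -/
theorem Admissible.integral_sq_obsCost_le (h : I.Admissible Θ D σw) {M R : ℝ} (hM : 0 ≤ M)
    (hA : ∀ j x, ‖(I.A j).toEuclideanLin x‖ ≤ M * ‖x‖) (hb : ∀ j, ‖I.b j‖ ≤ M)
    {x : Vec n} (hx : ‖x‖ ≤ R) (i : Fin K) :
    ∫ z, I.obsCost x z ^ 2 ∂(I.next i) ≤ 2 * R ^ 2 * ((M * R + M) ^ 2 + n * σw ^ 2) := by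
  have hR : 0 ≤ R := (norm_nonneg x).trans hx
  rw [I.integral_next h.P_nonneg i fun j => (h.memLp_obsCost x j).integrable_sq]
  have key : ∀ j, ∫ w, I.obsCost x (j, w) ^ 2 ∂(I.f j) ≤
      2 * R ^ 2 * ((M * R + M) ^ 2 + n * σw ^ 2) := by
    intro j
    have := h.noise_prob j
    have hint : Integrable (fun w : Vec n => ‖w‖ ^ 2) (I.f j) :=
      (h.memLp_noise j).norm.integrable_sq
    have hpt : ∀ w, I.obsCost x (j, w) ^ 2 ≤ 2 * R ^ 2 * (M * R + M) ^ 2 + 2 * R ^ 2 * ‖w‖ ^ 2 := by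
      intro w
      have h1 : |I.obsCost x (j, w)| ≤ R * ((M * R + M) + ‖w‖) := by
        rw [obsCost, abs_neg]
        refine (abs_real_inner_le_norm _ _).trans ?_
        refine mul_le_mul hx ?_ (norm_nonneg _) hR
        refine (norm_add_le _ _).trans ?_
        gcongr
        refine (norm_add_le _ _).trans ?_
        gcongr
        · exact (hA j x).trans (by gcongr)
        · exact hb j
      have h2 := pow_le_pow_left₀ (abs_nonneg _) h1 2
      rw [sq_abs] at h2
      refine h2.trans ?_
      nlinarith [mul_nonneg (sq_nonneg R) (sq_nonneg ((M * R + M) - ‖w‖))]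
    refine (integral_mono (h.memLp_obsCost x j).integrable_sq
      ((integrable_const _).add (hint.const_mul _)) hpt).trans ?_
    rw [integral_add' (integrable_const _) (hint.const_mul _), integral_const, integral_const_mul]
    have := h.integral_norm_sq_noise_le j
    simp only [probReal_univ, one_smul]
    nlinarith [mul_le_mul_of_nonneg_left this (mul_nonneg zero_le_two (sq_nonneg R))]
  refine (Finset.sum_le_sum fun j _ => mul_le_mul_of_nonneg_left (key j) (h.P_nonneg i j)).trans ?_
  rw [← Finset.sum_mul, h.P_sum, one_mul]

end Model

theorem Measurable.obsCost {K n : ℕ} {I : Model K n} {α : Type*} [MeasurableSpace α] {f : α → Vec n}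
    {g : α → Fin K × Vec n} (hf : Measurable f) (hg : Measurable g) :
    Measurable fun a => I.obsCost (f a) (g a) := by
  have h : Measurable fun a => (f a, g a) := hf.prodMk hg
  have h' := I.measurable_obsCost.comp h
  simp only [Function.comp_def] at h'
  exact h'

theorem Model.Admissible.memLp_obsCost_next {K n : ℕ} {I : Model K n} {Θ : Set (Params K n)}
    {D : Set (Vec n)} {σw : ℝ} (h : I.Admissible Θ D σw) (x : Vec n) (i : Fin K) :
    MemLp (I.obsCost x) 2 (I.next i) := by
  have hm : Measurable fun z => I.obsCost x z :=
    Measurable.obsCost measurable_const measurable_id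
  have hi : Integrable (fun z => I.obsCost x z ^ 2) (I.next i) :=
    I.integrable_next i fun j => (h.memLp_obsCost x j).integrable_sq
  exact (memLp_two_iff_integrable_sq hm.aestronglyMeasurable).2 hi

/-! ### Moments of the perturbation vectors. -/

namespace MSPSA

variable {K n : ℕ} {p : MSPSA K n} {D : Set (Vec n)} {ξ₁ ξ₂ : ℝ}

/-- The convention `1 / 0 = ∞` in the inverse second moment rules out an atom at zero. The
real-valued inverse, with `1 / 0 = 0`, can then be used almost everywhere. -/
theorem Valid.ae_ne_zero (hp : p.Valid D ξ₁ ξ₂) : ∀ᵐ x ∂p.ν, x ≠ 0 := by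
  have h := ae_lt_top (μ := p.ν) (f := fun x : ℝ => (ENNReal.ofReal (x ^ 2))⁻¹) (by fun_prop)
    (ne_top_of_le_ne_top ENNReal.ofReal_ne_top hp.ν_inv)
  filter_upwards [h] with x hx h0
  simp [h0] at hx

theorem Valid.lintegral_inv_sq_le (hp : p.Valid D ξ₁ ξ₂) :
    ∫⁻ x, ENNReal.ofReal ((1 / x) ^ 2) ∂p.ν ≤ ENNReal.ofReal ξ₂ := by
  refine (lintegral_mono_ae ?_).trans hp.ν_inv
  filter_upwards [hp.ae_ne_zero] with x hx
  rw [← ENNReal.ofReal_inv_of_pos (by positivity)]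
  simp

theorem Valid.memLp_inv (hp : p.Valid D ξ₁ ξ₂) : MemLp (fun x : ℝ => 1 / x) 2 p.ν := by
  have hm : Measurable fun x : ℝ => 1 / x := by fun_prop
  rw [memLp_two_iff_integrable_sq hm.aestronglyMeasurable]
  refine ⟨(hm.pow_const 2).aestronglyMeasurable, ?_⟩
  rw [hasFiniteIntegral_iff_ofReal (ae_of_all _ fun x => sq_nonneg _)]
  exact hp.lintegral_inv_sq_le.trans_lt ENNReal.ofReal_lt_top

theorem Valid.integral_inv_sq_le (hp : p.Valid D ξ₁ ξ₂) (hξ₂ : 0 ≤ ξ₂) :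
    ∫ x, (1 / x) ^ 2 ∂p.ν ≤ ξ₂ := by
  rw [integral_eq_lintegral_of_nonneg_ae (ae_of_all _ fun x => sq_nonneg _)
    hp.memLp_inv.integrable_sq.aestronglyMeasurable]
  exact ENNReal.toReal_le_of_le_ofReal hξ₂ hp.lintegral_inv_sq_le

theorem Valid.integral_id (hp : p.Valid D ξ₁ ξ₂) : ∫ x, x ∂p.ν = 0 := by
  have h : ∫ x, x ∂p.ν = ∫ x, -x ∂p.ν := by
    conv_lhs => rw [← hp.ν_symm]
    rw [integral_map (by fun_prop) (by fun_prop)]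
  rw [integral_neg] at h
  linarith

/-- The law of a perturbation vector, as a measure on functions `Fin n → ℝ`. -/
def pertLaw (p : MSPSA K n) : Measure (Fin n → ℝ) := Measure.pi fun _ => p.ν

theorem Valid.isProbabilityMeasure_pertLaw (hp : p.Valid D ξ₁ ξ₂) :
    IsProbabilityMeasure p.pertLaw := by
  have := hp.ν_prob
  unfold pertLaw
  infer_instance

theorem Valid.ae_pertLaw (hp : p.Valid D ξ₁ ξ₂) {P : ℝ → Prop} (h : ∀ᵐ x ∂p.ν, P x) :
    ∀ᵐ v ∂p.pertLaw, ∀ l, P (v l) := by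
  have := hp.ν_prob
  rw [ae_all_iff]
  intro l
  exact (measurePreserving_eval (fun _ : Fin n => p.ν) l).quasiMeasurePreserving.ae h

theorem Valid.integrable_inv_mul (hp : p.Valid D ξ₁ ξ₂) (l m : Fin n) :
    Integrable (fun v : Fin n → ℝ => 1 / v l * v m) p.pertLaw := by
  have := hp.ν_prob
  have h1 : Integrable (fun v : Fin n → ℝ => 1 / v l) p.pertLaw :=
    integrable_comp_eval (μ := fun _ : Fin n => p.ν) (hp.memLp_inv.integrable one_le_two)
  refine h1.mul_bdd (c := ξ₁) (measurable_pi_apply m).aestronglyMeasurable ?_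
  filter_upwards [hp.ae_pertLaw hp.ν_bdd] with v hv using hv m

/-- On the diagonal the product is almost surely `1`. Off the diagonal, independence splits the
integral and the factor of the centred entry `v m` vanishes; nothing is needed about the mean of `1
/ v l`. -/
theorem Valid.integral_inv_mul (hp : p.Valid D ξ₁ ξ₂) (l m : Fin n) :
    ∫ v, 1 / v l * v m ∂p.pertLaw = if l = m then 1 else 0 := by
  have := hp.ν_prob
  have := hp.isProbabilityMeasure_pertLaw
  split_ifs with h
  · subst h
    have : (fun v : Fin n → ℝ => 1 / v l * v l) =ᵐ[p.pertLaw] fun _ => 1 := by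
      filter_upwards [hp.ae_pertLaw hp.ae_ne_zero] with v hv
      exact one_div_mul_cancel (hv l)
    rw [integral_congr_ae this]
    simp
  · let f : Fin n → ℝ → ℝ := fun q x => if q = l then 1 / x else if q = m then x else 1
    have e : (fun v : Fin n → ℝ => 1 / v l * v m) = fun v => ∏ q, f q (v q) := by
      funext v
      have : ∀ q, f q (v q) = (if q = l then 1 / v l else 1) * (if q = m then v m else 1) := by
        intro q
        by_cases h1 : q = l
        · subst h1; simp [f, h]
        · by_cases h2 : q = m
          · subst h2; simp [f, h1]
          · simp [f, h1, h2]
      simp only [this, Finset.prod_mul_distrib, Finset.prod_ite_eq', Finset.mem_univ, if_true]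
    rw [e, pertLaw, integral_fintype_prod_eq_prod]
    refine Finset.prod_eq_zero (Finset.mem_univ m) ?_
    simp only [f, if_neg (Ne.symm h), if_true]
    exact hp.integral_id

/-- The entrywise inverse of a vector. -/
def invVec (v : Fin n → ℝ) : Vec n := WithLp.toLp 2 fun l => 1 / v l

theorem inner_invVec_mul_inner (e g : Vec n) (v : Fin n → ℝ) :
    inner ℝ e (invVec v) * inner ℝ (WithLp.toLp 2 v) g =
      ∑ l, ∑ m, e l * g m * (1 / v l * v m) := by
  simp only [PiLp.inner_apply, invVec, Finset.sum_mul_sum, RCLike.inner_apply, conj_trivial]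
  refine Finset.sum_congr rfl fun l _ => Finset.sum_congr rfl fun m _ => by ring

theorem Valid.integrable_inner_invVec_mul_inner (hp : p.Valid D ξ₁ ξ₂) (e g : Vec n) :
    Integrable (fun v => inner ℝ e (invVec v) * inner ℝ (WithLp.toLp 2 v) g) p.pertLaw := by
  simp only [inner_invVec_mul_inner]
  exact integrable_finsetSum _ fun l _ => integrable_finsetSum _ fun m _ =>
    (hp.integrable_inv_mul l m).const_mul _

/-- This is the unbiasedness of simultaneous perturbation: multiplying a directional derivative by
the entrywise inverse of the direction recovers the gradient on average. -/
theorem Valid.integral_inner_invVec_mul_inner (hp : p.Valid D ξ₁ ξ₂) (e g : Vec n) :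
    ∫ v, inner ℝ e (invVec v) * inner ℝ (WithLp.toLp 2 v) g ∂p.pertLaw = inner ℝ e g := by
  simp only [inner_invVec_mul_inner]
  rw [integral_finsetSum _ fun l _ => integrable_finsetSum _ fun m _ =>
    (hp.integrable_inv_mul l m).const_mul _]
  have : ∀ l, ∫ v, ∑ m, e l * g m * (1 / v l * v m) ∂p.pertLaw = e l * g l := by
    intro l
    rw [integral_finsetSum _ fun m _ => (hp.integrable_inv_mul l m).const_mul _]
    simp only [integral_const_mul, hp.integral_inv_mul, mul_ite, mul_one, mul_zero,
      Finset.sum_ite_eq, Finset.mem_univ, if_true]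
  simp only [this, PiLp.inner_apply, RCLike.inner_apply, conj_trivial]
  exact Finset.sum_congr rfl fun l _ => mul_comm _ _

theorem Valid.integrable_norm_sq_invVec (hp : p.Valid D ξ₁ ξ₂) :
    Integrable (fun v => ‖(invVec v : Vec n)‖ ^ 2) p.pertLaw := by
  have := hp.ν_prob
  simp only [EuclideanSpace.real_norm_sq_eq]
  exact integrable_finsetSum _ fun l _ =>
    integrable_comp_eval (μ := fun _ : Fin n => p.ν) (f := fun x => (1 / x) ^ 2)
      hp.memLp_inv.integrable_sq

theorem Valid.integral_norm_sq_invVec_le (hp : p.Valid D ξ₁ ξ₂) (hξ₂ : 0 ≤ ξ₂) :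
    ∫ v, ‖(invVec v : Vec n)‖ ^ 2 ∂p.pertLaw ≤ n * ξ₂ := by
  have := hp.ν_prob
  have hint : ∀ l : Fin n, Integrable (fun v => (invVec v : Vec n) l ^ 2) p.pertLaw := fun l =>
    integrable_comp_eval (μ := fun _ : Fin n => p.ν) (f := fun x => (1 / x) ^ 2)
      hp.memLp_inv.integrable_sq
  simp only [EuclideanSpace.real_norm_sq_eq]
  rw [integral_finsetSum _ fun l _ => hint l]
  have : ∀ l : Fin n, ∫ v, (invVec v : Vec n) l ^ 2 ∂p.pertLaw ≤ ξ₂ := fun l => by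
    refine le_of_eq_of_le ?_ (hp.integral_inv_sq_le hξ₂)
    exact integral_comp_eval (μ := fun _ : Fin n => p.ν) (i := l) (f := fun x => (1 / x) ^ 2)
      hp.memLp_inv.integrable_sq.aestronglyMeasurable
  refine (Finset.sum_le_sum fun l _ => this l).trans ?_
  simp

theorem norm_le_of_abs_le {v : Vec n} {ξ : ℝ} (h : ∀ l, |v l| ≤ ξ) :
    ‖v‖ ^ 2 ≤ n * ξ ^ 2 := by
  rw [EuclideanSpace.real_norm_sq_eq]
  refine (Finset.sum_le_sum fun l _ => ?_).trans (b := ∑ _l : Fin n, ξ ^ 2) (by simp)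
  rw [← sq_abs]
  exact pow_le_pow_left₀ (abs_nonneg _) (h l) 2

end MSPSA

/-! ### One step of stochastic approximation. -/

/-- The estimate `(a - b)² ≤ 2 a² + 2 b²` removes the cross term, so the bound splits into a
function of `a` plus a function of `b`, which can be integrated one observation at a time. -/
theorem norm_sub_smul_sq_le {n : ℕ} (e u : Vec n) (h a b : ℝ) :
    ‖e - (h * (a - b)) • u‖ ^ 2 ≤
      ‖e‖ ^ 2 - 2 * h * inner ℝ e u * (a - b) + 2 * h ^ 2 * ‖u‖ ^ 2 * (a ^ 2 + b ^ 2) := by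
  rw [norm_sub_sq_real, inner_smul_right, norm_smul, mul_pow, Real.norm_eq_abs, sq_abs]
  nlinarith [mul_nonneg (mul_nonneg (sq_nonneg h) (sq_nonneg ‖u‖)) (sq_nonneg (a + b))]

/-- The mean square error after a stochastic approximation step along `u` that uses two
independent observations. -/
theorem lintegral_lintegral_norm_sub_smul_sq_le {n : ℕ} {α : Type*} [MeasurableSpace α]
    {Q : Measure α} [IsProbabilityMeasure Q] {f g : α → ℝ} (hf : MemLp f 2 Q) (hg : MemLp g 2 Q)
    {S : ℝ} (hfS : ∫ z, f z ^ 2 ∂Q ≤ S) (hgS : ∫ z, g z ^ 2 ∂Q ≤ S) (e u : Vec n) (h : ℝ) :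
    ∫⁻ z, ∫⁻ z', ENNReal.ofReal (‖e - (h * (f z - g z')) • u‖ ^ 2) ∂Q ∂Q ≤
      ENNReal.ofReal (‖e‖ ^ 2 - 2 * h * inner ℝ e u * (∫ z, f z ∂Q - ∫ z, g z ∂Q)
        + 4 * S * h ^ 2 * ‖u‖ ^ 2) ∧
    -- Nonnegativity is recorded because this expression is later integrated over `u`, and
    -- `ENNReal.ofReal` commutes with that integral only where it is nonnegative.
    0 ≤ ‖e‖ ^ 2 - 2 * h * inner ℝ e u * (∫ z, f z ∂Q - ∫ z, g z ∂Q) + 4 * S * h ^ 2 * ‖u‖ ^ 2 := by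
  set c₁ := 2 * h * inner ℝ e u
  set c₂ := 2 * h ^ 2 * ‖u‖ ^ 2
  have hc₂ : 0 ≤ c₂ := by positivity
  have hf1 := hf.integrable one_le_two
  have hg1 := hg.integrable one_le_two
  have hf2 := hf.integrable_sq
  have hg2 := hg.integrable_sq
  let A : α → ℝ := fun z => ‖e‖ ^ 2 - c₁ * f z + c₂ * f z ^ 2
  let B : α → ℝ := fun z => c₁ * g z + c₂ * g z ^ 2
  have hA : Integrable A Q :=
    ((integrable_const _).sub (hf1.const_mul _)).add (hf2.const_mul _)
  have hB : Integrable B Q := (hg1.const_mul _).add (hg2.const_mul _)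
  have hAB : ∀ z z', ‖e - (h * (f z - g z')) • u‖ ^ 2 ≤ A z + B z' := by
    intro z z'
    refine (norm_sub_smul_sq_le e u h _ _).trans (le_of_eq ?_)
    simp only [A, B, c₁, c₂]
    ring
  have h0 : ∀ z z', 0 ≤ A z + B z' := fun z z' => (sq_nonneg _).trans (hAB z z')
  have hin : ∀ z, ∫⁻ z', ENNReal.ofReal (A z + B z') ∂Q = ENNReal.ofReal (A z + ∫ z', B z' ∂Q) := by
    intro z
    have hi : Integrable (fun z' => A z + B z') Q := (integrable_const _).add hB
    rw [← ofReal_integral_eq_lintegral_ofReal hi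
      (ae_of_all _ fun z' => h0 z z'), integral_add (integrable_const _) hB]
    simp
  have h1 : ∀ z, 0 ≤ A z + ∫ z', B z' ∂Q := by
    intro z
    have : A z + ∫ z', B z' ∂Q = ∫ z', (A z + B z') ∂Q := by
      rw [integral_add (integrable_const _) hB]; simp
    rw [this]
    exact integral_nonneg (h0 z)
  have hsum : ∫ z, (A z + ∫ z', B z' ∂Q) ∂Q = (∫ z, A z ∂Q) + ∫ z, B z ∂Q := by
    rw [integral_add hA (integrable_const _)]; simp
  have hAi : ∫ z, A z ∂Q = ‖e‖ ^ 2 - c₁ * ∫ z, f z ∂Q + c₂ * ∫ z, f z ^ 2 ∂Q := by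
    have hi : Integrable (fun z => ‖e‖ ^ 2 - c₁ * f z) Q :=
      (integrable_const _).sub (hf1.const_mul _)
    simp only [A]
    rw [integral_add hi (hf2.const_mul _),
      integral_sub (integrable_const _) (hf1.const_mul _), integral_const_mul, integral_const_mul]
    simp
  have hBi : ∫ z, B z ∂Q = c₁ * ∫ z, g z ∂Q + c₂ * ∫ z, g z ^ 2 ∂Q := by
    simp only [B]
    rw [integral_add (hg1.const_mul _) (hg2.const_mul _), integral_const_mul, integral_const_mul]
  have hle : (∫ z, A z ∂Q) + ∫ z, B z ∂Q ≤
      ‖e‖ ^ 2 - c₁ * (∫ z, f z ∂Q - ∫ z, g z ∂Q) + 4 * S * h ^ 2 * ‖u‖ ^ 2 := by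
    rw [hAi, hBi]
    have := mul_le_mul_of_nonneg_left (add_le_add hfS hgS) hc₂
    simp only [c₂] at this ⊢
    linarith
  refine ⟨?_, ?_⟩
  · calc _ ≤ ∫⁻ z, ∫⁻ z', ENNReal.ofReal (A z + B z') ∂Q ∂Q :=
          lintegral_mono fun z => lintegral_mono fun z' => ENNReal.ofReal_le_ofReal (hAB z z')
      _ = ENNReal.ofReal ((∫ z, A z ∂Q) + ∫ z, B z ∂Q) := by
          have hi : Integrable (fun z => A z + ∫ z', B z' ∂Q) Q := hA.add (integrable_const _)
          simp only [hin]
          rw [← ofReal_integral_eq_lintegral_ofReal hi (ae_of_all _ h1), hsum]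
      _ ≤ _ := ENNReal.ofReal_le_ofReal hle
  · refine le_trans ?_ hle
    rw [← hsum]
    exact integral_nonneg h1

namespace MSPSA

variable {K n : ℕ} (p : MSPSA K n)

/-- The estimate that MSPSA computes from the observed costs `dPlus` and `dMinus`. -/
def newEst (D : Set (Vec n)) (i : Fin K) (k : ℕ) (x : Vec n) (dPlus dMinus : ℝ)
    (v : Fin n → ℝ) : Vec n :=
  euclProj D (x - (p.stepGain i k * ((dPlus - dMinus) / p.pertGain i k)) • invVec v)

variable {p} {I : Model K n} {Θ : Set (Params K n)} {D : Set (Vec n)} {σw ξ₁ ξ₂ : ℝ}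

theorem Valid.pertGain_pos (hp : p.Valid D ξ₁ ξ₂) (i : Fin K) {k : ℕ} (hk : 1 ≤ k) :
    0 < p.pertGain i k := by
  have : (1 : ℝ) ≤ k := by exact_mod_cast hk
  exact div_pos (hp.γ'_pos i) (Real.rpow_pos_of_pos (by positivity) _)

/-- The mean square error after one step of MSPSA. -/
theorem Valid.lintegral_newEst_le (hp : p.Valid D ξ₁ ξ₂) (hξ₂ : 0 ≤ ξ₂) (hD : IsCompact D)
    (hconv : Convex ℝ D) (h : I.Admissible Θ D σw) (hstep : p.StepCondition I)
    (i : Fin K) {k : ℕ} (hk : 1 ≤ k) (x : Vec n) {S : ℝ}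
    (hS : ∀ v : Vec n, (∀ l, |v l| ≤ ξ₁) →
      ∫ z, I.obsCost (x + p.pertGain i k • v) z ^ 2 ∂(I.next i) ≤ S ∧
      ∫ z, I.obsCost (x - p.pertGain i k • v) z ^ 2 ∂(I.next i) ≤ S) :
    ∫⁻ v, ∫⁻ z, ∫⁻ z', ‖p.newEst D i k x
        (I.obsCost (x + p.pertGain i k • WithLp.toLp 2 v) z)
        (I.obsCost (x - p.pertGain i k • WithLp.toLp 2 v) z') v - I.optInput i‖ₑ ^ 2
        ∂(I.next i) ∂(I.next i) ∂p.pertLaw ≤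
      ENNReal.ofReal ((1 - 1 / (p.N i + k)) * ‖x - I.optInput i‖ ^ 2 +
        4 * S * (p.stepGain i k / p.pertGain i k) ^ 2 * (n * ξ₂)) := by
  have := h.isProbabilityMeasure_next i
  have := hp.isProbabilityMeasure_pertLaw
  set c := p.pertGain i k with hc
  set a := p.stepGain i k with ha
  have hc0 : 0 < c := hp.pertGain_pos i hk
  set e := x - I.optInput i with he
  set g := (I.hess i).toEuclideanLin e with hg
  -- The zero direction is an allowed perturbation: `ν` is a probability measure, so some `y` has
  -- `|y| ≤ ξ₁`, whence `0 ≤ ξ₁`.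
  have hS0 : 0 ≤ S := by
    have hx := (hS (WithLp.toLp 2 0) (fun l => by
      have hb : ∃ y : ℝ, |y| ≤ ξ₁ := by
        have := hp.ν_prob
        exact hp.ν_bdd.exists
      obtain ⟨y, hy⟩ := hb
      simpa using (abs_nonneg y).trans hy)).1
    exact (integral_nonneg fun z => sq_nonneg _).trans hx
  let G : (Fin n → ℝ) → ℝ := fun v => ‖e‖ ^ 2 -
    4 * a * (inner ℝ e (invVec v) * inner ℝ (WithLp.toLp 2 v) g) +
    4 * S * (a / c) ^ 2 * ‖(invVec v : Vec n)‖ ^ 2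
  have hmem : ∀ y : Vec n, MemLp (I.obsCost y) 2 (I.next i) := fun y => h.memLp_obsCost_next y i
  have hG1 : Integrable (fun v => ‖e‖ ^ 2 -
      4 * a * (inner ℝ e (invVec v) * inner ℝ (WithLp.toLp 2 v) g)) p.pertLaw :=
    (integrable_const _).sub ((hp.integrable_inner_invVec_mul_inner e g).const_mul _)
  have hGint : Integrable G p.pertLaw :=
    hG1.add (hp.integrable_norm_sq_invVec.const_mul _)
  have hGi : ∫ v, G v ∂p.pertLaw = ‖e‖ ^ 2 - 4 * a * inner ℝ e g +
      4 * S * (a / c) ^ 2 * ∫ v, ‖(invVec v : Vec n)‖ ^ 2 ∂p.pertLaw := by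
    simp only [G]
    rw [integral_add hG1 (hp.integrable_norm_sq_invVec.const_mul _), integral_sub (integrable_const _)
      ((hp.integrable_inner_invVec_mul_inner e g).const_mul _), integral_const_mul,
      integral_const_mul, hp.integral_inner_invVec_mul_inner]
    simp
  have hae : ∀ᵐ v ∂p.pertLaw, (∫⁻ z, ∫⁻ z', ‖p.newEst D i k x
        (I.obsCost (x + c • WithLp.toLp 2 v) z)
        (I.obsCost (x - c • WithLp.toLp 2 v) z') v - I.optInput i‖ₑ ^ 2
        ∂(I.next i) ∂(I.next i) ≤ ENNReal.ofReal (G v)) ∧ 0 ≤ G v := by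
    filter_upwards [hp.ae_pertLaw hp.ν_bdd] with v hv
    have hSv := hS (WithLp.toLp 2 v) hv
    have key := lintegral_lintegral_norm_sub_smul_sq_le (hmem (x + c • WithLp.toLp 2 v))
      (hmem (x - c • WithLp.toLp 2 v)) hSv.1 hSv.2 e (invVec v) (a / c)
    rw [h.integral_next_obsCost, h.integral_next_obsCost, h.stageCost_add_sub_sub] at key
    -- The gain `c` in the exact difference `2 c ⟪v, H e⟫` cancels the one in `a / c`, so the drift
    -- is free of `c`.
    have eG : ‖e‖ ^ 2 - 2 * (a / c) * inner ℝ e (invVec v) *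
        (2 * c * inner ℝ (WithLp.toLp 2 v) ((I.hess i).toEuclideanLin (x - I.optInput i))) +
        4 * S * (a / c) ^ 2 * ‖(invVec v : Vec n)‖ ^ 2 = G v := by
      simp only [G, hg, he]
      field_simp
      ring
    rw [eG] at key
    refine ⟨le_trans ?_ key.1, key.2⟩
    refine lintegral_mono fun z => lintegral_mono fun z' => ?_
    rw [← ofReal_norm, ← ENNReal.ofReal_pow (norm_nonneg _)]
    refine ENNReal.ofReal_le_ofReal (pow_le_pow_left₀ (norm_nonneg _) ?_ 2)
    refine (norm_euclProj_sub_le hD hconv _ (h.optInput_mem i)).trans (le_of_eq ?_)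
    rw [he]
    congr 1
    rw [sub_right_comm, mul_div_assoc', mul_div_right_comm]
  calc _ ≤ ∫⁻ v, ENNReal.ofReal (G v) ∂p.pertLaw := lintegral_mono_ae (hae.mono fun v hv => hv.1)
    _ = ENNReal.ofReal (∫ v, G v ∂p.pertLaw) :=
        (ofReal_integral_eq_lintegral_ofReal hGint (hae.mono fun v hv => hv.2)).symm
    _ ≤ _ := by
        refine ENNReal.ofReal_le_ofReal ?_
        rw [hGi]
        have h1 := h.le_inner_hess hp.γ_pos hstep i e
        have hk' : (1 : ℝ) ≤ k := by exact_mod_cast hk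
        have hNk : (0 : ℝ) < p.N i + k := by positivity
        have h2 : 1 / (p.N i + k) * ‖e‖ ^ 2 ≤ 4 * a * inner ℝ e g := by
          have : 4 * a * inner ℝ e g = 1 / (p.N i + k) * (4 * p.γ i * inner ℝ e g) := by
            simp only [ha, stepGain]
            field_simp
          rw [this]
          exact mul_le_mul_of_nonneg_left h1 (by positivity)
        have h3 := mul_le_mul_of_nonneg_left (hp.integral_norm_sq_invVec_le hξ₂)
          (show 0 ≤ 4 * S * (a / c) ^ 2 by positivity)
        linarith

end MSPSA

/-! ### Measurability of the policy. -/

theorem Measurable.apply_countable {ι α β : Type*} [Countable ι] [MeasurableSpace ι]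
    [MeasurableSingletonClass ι] [MeasurableSpace α] [MeasurableSpace β] {F : ι → α → β}
    (hF : ∀ j, Measurable (F j)) {i : α → ι} (hi : Measurable i) :
    Measurable fun a => F (i a) a := by
  have h := (measurable_from_prod_countable_right (f := fun q : ι × α => F q.1 q.2) hF).comp
    (hi.prodMk measurable_id)
  simp only [Function.comp_def, id] at h
  exact h

theorem Measurable.function_update {ι α β : Type*} [DecidableEq ι] [MeasurableSpace α]
    [MeasurableSpace β] {f : α → ι → β} {x : α → β} (hf : Measurable f) (i : ι)
    (hx : Measurable x) : Measurable fun a => Function.update (f a) i (x a) := by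
  have h := (measurable_update' (a := i) (X := fun _ : ι => β)).comp (hf.prodMk hx)
  simp only [Function.comp_def] at h
  exact h

theorem Measurable.const_smul_vec {n : ℕ} {α : Type*} [MeasurableSpace α] {v : α → Vec n}
    (hv : Measurable v) (c : ℝ) : Measurable fun a => c • v a := hv.const_smul c

namespace MSPSA

variable {K n : ℕ}

/-- Pulling the σ-algebra back from the tuple of fields reduces measurability of memories to that of
their fields. -/
instance : MeasurableSpace (Memory K n) :=
  MeasurableSpace.comap (fun m => (m.count, m.flag, m.est, m.dPlus)) inferInstance

theorem measurable_memory_fields :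
    Measurable fun m : Memory K n => (m.count, m.flag, m.est, m.dPlus) := comap_measurable _

theorem measurable_count (i : Fin K) : Measurable fun m : Memory K n => m.count i :=
  (measurable_pi_apply i).comp measurable_memory_fields.fst

theorem measurable_flag (i : Fin K) : Measurable fun m : Memory K n => m.flag i :=
  (measurable_pi_apply i).comp measurable_memory_fields.snd.fst

theorem measurable_est (i : Fin K) : Measurable fun m : Memory K n => m.est i :=
  (measurable_pi_apply i).comp measurable_memory_fields.snd.snd.fst

theorem measurable_dPlus (i : Fin K) : Measurable fun m : Memory K n => m.dPlus i :=
  (measurable_pi_apply i).comp measurable_memory_fields.snd.snd.snd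

variable {α : Type*} [MeasurableSpace α]

theorem measurable_memory_mk {c : α → Fin K → ℕ} {f : α → Fin K → Bool} {x : α → Fin K → Vec n}
    {d : α → Fin K → ℝ} (hc : Measurable c) (hf : Measurable f) (hx : Measurable x)
    (hd : Measurable d) : Measurable fun a => (⟨c a, f a, x a, d a⟩ : Memory K n) := by
  rw [measurable_comap_iff]
  exact hc.prodMk (hf.prodMk (hx.prodMk hd))

variable (p : MSPSA K n) {m : α → Memory K n} {δ : Fin K → ℕ → α → Vec n} {i : α → Fin K}

theorem measurable_input_const (hm : Measurable m) (hδ : ∀ i k, Measurable (δ i k)) (i : Fin K) :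
    Measurable fun a => p.input (m a) (fun i k => δ i k a) i := by
  unfold input
  have hc : Measurable fun a => (m a).count i := (measurable_count i).comp hm
  have hf : Measurable fun a => (m a).flag i := (measurable_flag i).comp hm
  have he : Measurable fun a => (m a).est i := (measurable_est i).comp hm
  refine Measurable.ite (hf (measurableSet_singleton true)) ?_ ?_
  · exact he.sub (Measurable.apply_countable
      (F := fun k a => p.pertGain i k • δ i k a) (fun k => (hδ i k).const_smul_vec _) hc)
  · exact he.add (Measurable.apply_countable
      (F := fun k a => p.pertGain i (k + 1) • δ i (k + 1) a)
      (fun k => (hδ i (k + 1)).const_smul_vec _) hc)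

theorem measurable_input (hm : Measurable m) (hδ : ∀ i k, Measurable (δ i k))
    (hi : Measurable i) : Measurable fun a => p.input (m a) (fun i k => δ i k a) (i a) :=
  Measurable.apply_countable (fun i => p.measurable_input_const hm hδ i) hi

theorem measurable_invVec : Measurable (invVec : (Fin n → ℝ) → Vec n) := by
  refine (WithLp.measurable_toLp 2 _).comp (measurable_pi_lambda _ fun l => ?_)
  exact (measurable_pi_apply l).const_div 1

theorem measurable_newEst {D : Set (Vec n)} (hD : Measurable (euclProj D)) (i : Fin K) (k : ℕ)
    {x : α → Vec n} {d d' : α → ℝ} {v : α → Fin n → ℝ} (hx : Measurable x) (hd : Measurable d)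
    (hd' : Measurable d') (hv : Measurable v) :
    Measurable fun a => p.newEst D i k (x a) (d a) (d' a) (v a) := by
  have h1 : Measurable fun a => p.stepGain i k * ((d a - d' a) / p.pertGain i k) :=
    ((hd.sub hd').div_const _).const_mul _
  have h2 : Measurable fun a => (invVec (v a) : Vec n) := measurable_invVec.comp hv
  exact hD.comp (hx.sub (h1.smul h2))

theorem input_of_flag_true {m : Memory K n} {i : Fin K} (h : m.flag i = true)
    (δ : Fin K → ℕ → Vec n) :
    p.input m δ i = m.est i - p.pertGain i (m.count i) • δ i (m.count i) := by
  simp [input, h]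

theorem input_of_flag_false {m : Memory K n} {i : Fin K} (h : m.flag i = false)
    (δ : Fin K → ℕ → Vec n) :
    p.input m δ i = m.est i + p.pertGain i (m.count i + 1) • δ i (m.count i + 1) := by
  simp [input, h]

theorem update_of_flag_true (D : Set (Vec n)) {m : Memory K n} {i : Fin K} (h : m.flag i = true)
    (δ : Fin K → ℕ → Vec n) (y : Vec n) :
    p.update D m δ i y = ⟨m.count, Function.update m.flag i false, Function.update m.est i
      (p.newEst D i (m.count i) (m.est i) (m.dPlus i)
        (-inner ℝ (m.est i - p.pertGain i (m.count i) • δ i (m.count i)) y)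
        (δ i (m.count i)).ofLp), m.dPlus⟩ := by
  simp only [update, input, h, if_true]
  rfl

theorem update_of_flag_false (D : Set (Vec n)) {m : Memory K n} {i : Fin K}
    (h : m.flag i = false) (δ : Fin K → ℕ → Vec n) (y : Vec n) :
    p.update D m δ i y = ⟨Function.update m.count i (m.count i + 1),
      Function.update m.flag i true, m.est, Function.update m.dPlus i
        (-inner ℝ (m.est i + p.pertGain i (m.count i + 1) • δ i (m.count i + 1)) y)⟩ := by
  simp [update, input, h]

theorem measurable_update_const {D : Set (Vec n)} (hD : Measurable (euclProj D))
    (hm : Measurable m) (hδ : ∀ i k, Measurable (δ i k)) (i : Fin K) {y : α → Vec n}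
    (hy : Measurable y) :
    Measurable fun a => p.update D (m a) (fun i k => δ i k a) i (y a) := by
  have hc : Measurable fun a => (m a).count i := (measurable_count i).comp hm
  have hf : Measurable fun a => (m a).flag i := (measurable_flag i).comp hm
  have he : Measurable fun a => (m a).est i := (measurable_est i).comp hm
  have hd : Measurable fun a => (m a).dPlus i := (measurable_dPlus i).comp hm
  have hC : Measurable fun a => (m a).count := measurable_memory_fields.fst.comp hm
  have hF : Measurable fun a => (m a).flag := measurable_memory_fields.snd.fst.comp hm
  have hE : Measurable fun a => (m a).est := measurable_memory_fields.snd.snd.fst.comp hm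
  have hP : Measurable fun a => (m a).dPlus := measurable_memory_fields.snd.snd.snd.comp hm
  have e : (fun a => p.update D (m a) (fun i k => δ i k a) i (y a)) = fun a =>
      if (m a).flag i = true then
        (⟨(m a).count, Function.update (m a).flag i false, Function.update (m a).est i
          (p.newEst D i ((m a).count i) ((m a).est i) ((m a).dPlus i)
            (-inner ℝ ((m a).est i - p.pertGain i ((m a).count i) • δ i ((m a).count i) a) (y a))
            (δ i ((m a).count i) a).ofLp), (m a).dPlus⟩ : Memory K n)
      else ⟨Function.update (m a).count i ((m a).count i + 1),
        Function.update (m a).flag i true, (m a).est, Function.update (m a).dPlus i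
          (-inner ℝ ((m a).est i + p.pertGain i ((m a).count i + 1) •
            δ i ((m a).count i + 1) a) (y a))⟩ := by
    funext a
    split_ifs with h
    · rw [update_of_flag_true p D h]
    · rw [update_of_flag_false p D (by simpa using h)]
  rw [e]
  refine Measurable.ite (hf (measurableSet_singleton true)) ?_ ?_
  · refine measurable_memory_mk hC ?_ ?_ hP
    · exact hF.function_update i measurable_const
    · refine hE.function_update i ?_
      refine Measurable.apply_countable (F := fun k a => p.newEst D i k ((m a).est i)
        ((m a).dPlus i) (-inner ℝ ((m a).est i - p.pertGain i k • δ i k a) (y a))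
        (δ i k a).ofLp) (fun k => ?_) hc
      refine p.measurable_newEst hD i k he hd ?_ ((WithLp.measurable_ofLp 2 _).comp (hδ i k))
      exact ((he.sub ((hδ i k).const_smul_vec _)).inner hy).neg
  · refine measurable_memory_mk ?_ ?_ hE ?_
    · exact hC.function_update i (hc.add_const 1)
    · exact hF.function_update i measurable_const
    · refine hP.function_update i ?_
      refine Measurable.apply_countable (F := fun k a =>
        -inner ℝ ((m a).est i + p.pertGain i (k + 1) • δ i (k + 1) a) (y a)) (fun k => ?_) hc
      exact ((he.add ((hδ i (k + 1)).const_smul_vec _)).inner hy).neg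

theorem measurable_update {D : Set (Vec n)} (hD : Measurable (euclProj D))
    (hm : Measurable m) (hδ : ∀ i k, Measurable (δ i k)) (hi : Measurable i) {y : α → Vec n}
    (hy : Measurable y) :
    Measurable fun a => p.update D (m a) (fun i k => δ i k a) (i a) (y a) :=
  Measurable.apply_countable (fun i => p.measurable_update_const hD hm hδ i hy) hi

theorem _root_.Model.measurable_output_comp (I : Model K n) {j : α → Fin K} {x w : α → Vec n}
    (hj : Measurable j) (hx : Measurable x) (hw : Measurable w) :
    Measurable fun a => I.output (j a) (x a) (w a) := by
  have h : Measurable fun a => (j a, x a, w a) := hj.prodMk (hx.prodMk hw)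
  have h' := I.measurable_output.comp h
  simp only [Function.comp_def] at h'
  exact h'

theorem measurable_memory {D : Set (Vec n)} (hD : Measurable (euclProj D)) (I : Model K n)
    {s : ℕ → α → Fin K} {w : ℕ → α → Vec n} (hδ : ∀ i k, Measurable (δ i k)) (t : ℕ)
    (hs : ∀ r ≤ t, Measurable (s r)) (hw : ∀ r < t, Measurable (w (r + 1))) :
    Measurable fun a => p.memory D I (fun r => s r a) (fun r => w r a) (fun i k => δ i k a) t := by
  induction t with
  | zero => exact measurable_const
  | succ t ih =>
    have ih := ih (fun r hr => hs r (by omega)) (fun r hr => hw r (by omega))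
    have hst := hs t (by omega)
    exact p.measurable_update hD ih hδ hst (I.measurable_output_comp (hs (t + 1) le_rfl)
      (p.measurable_input ih hδ hst) (hw t (by omega)))

/-! ### Pathwise properties of the memory. -/

section Deterministic

variable (D : Set (Vec n)) (I : Model K n) (s : ℕ → Fin K) (w : ℕ → Vec n)

theorem update_est_mem {D : Set (Vec n)} (hD : IsCompact D) (hne : D.Nonempty) {m : Memory K n}
    (hm : ∀ j, m.est j ∈ D) (δ : Fin K → ℕ → Vec n) (i : Fin K) (y : Vec n) (j : Fin K) :
    (p.update D m δ i y).est j ∈ D := by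
  cases h : m.flag i
  · rw [update_of_flag_false p D h]
    exact hm j
  · rw [update_of_flag_true p D h]
    simp only [Function.update_apply]
    split_ifs
    · exact (exists_euclProj_eq hD hne _).1
    · exact hm j

theorem memory_est_mem {D : Set (Vec n)} (hD : IsCompact D) (hx : ∀ i, p.xInit i ∈ D)
    (δ : Fin K → ℕ → Vec n) (t : ℕ) (j : Fin K) : (p.memory D I s w δ t).est j ∈ D := by
  induction t generalizing j with
  | zero => exact hx j
  | succ t ih => exact p.update_est_mem hD ⟨_, hx j⟩ ih _ _ _ j

theorem update_count_le (m : Memory K n) (δ : Fin K → ℕ → Vec n) (i : Fin K) (y : Vec n)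
    (j : Fin K) : m.count j ≤ (p.update D m δ i y).count j ∧
      (p.update D m δ i y).count j ≤ m.count j + 1 := by
  cases h : m.flag i
  · rw [update_of_flag_false p D h]
    simp only [Function.update_apply]
    split_ifs with hj
    · subst hj; omega
    · omega
  · rw [update_of_flag_true p D h]
    exact ⟨le_rfl, Nat.le_succ _⟩

theorem memory_count_le (δ : Fin K → ℕ → Vec n) (t : ℕ) (j : Fin K) :
    (p.memory D I s w δ t).count j ≤ t := by
  induction t with
  | zero => exact le_rfl
  | succ t ih => exact (p.update_count_le D _ δ _ _ j).2.trans (by omega)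

/-- The memory does not depend on perturbation vectors that have not been used yet. -/
theorem memory_congr {δ δ' : Fin K → ℕ → Vec n} {i : Fin K} {k : ℕ}
    (hδ : ∀ i' k', (i', k') ≠ (i, k) → δ i' k' = δ' i' k') (t : ℕ)
    (h : (p.memory D I s w δ t).count i < k) :
    p.memory D I s w δ t = p.memory D I s w δ' t := by
  induction t with
  | zero => rfl
  | succ t ih =>
    have hcount := (p.update_count_le D (p.memory D I s w δ t) δ (s t)
      (I.output (s (t + 1)) (p.input (p.memory D I s w δ t) δ (s t)) (w (t + 1))) i).1.trans_lt h
    have ih := ih hcount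
    simp only [memory] at h ⊢
    rw [← ih]
    generalize p.memory D I s w δ t = m at *
    -- The counter rises when a vector is first used, so every vector of state `i` read so far has
    -- index at most `count i`, which is below `k`; the replaced vector has not been read.
    have hne : ∀ k', (s t = i → k' < k) → δ (s t) k' = δ' (s t) k' := fun k' hk' =>
      hδ _ _ fun e => by
        have h1 := (Prod.mk.inj e)
        have := hk' h1.1
        omega
    cases hf : m.flag (s t)
    · have e : δ (s t) (m.count (s t) + 1) = δ' (s t) (m.count (s t) + 1) := by
        refine hne _ fun hi => ?_
        rw [update_of_flag_false p D hf] at h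
        simpa [hi] using h
      rw [update_of_flag_false p D hf, update_of_flag_false p D hf, input_of_flag_false p hf,
        input_of_flag_false p hf, e]
    · have e : δ (s t) (m.count (s t)) = δ' (s t) (m.count (s t)) :=
        hne _ fun hi => by rw [hi]; exact hcount
      rw [update_of_flag_true p D hf, update_of_flag_true p D hf, input_of_flag_true p hf,
        input_of_flag_true p hf, e]

end Deterministic

end MSPSA

/-! ### The past and the conditional law of the next state and noise. -/

namespace Realization

variable {K n : ℕ} {I : Model K n} {ν : Measure ℝ} (R : Realization I ν)

/-- The pair of the state and the noise at time `t`. -/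
def obs (t : ℕ) (ω : R.Ω) : Fin K × Vec n := (R.s t ω, R.w t ω)

/-- All perturbation vectors. -/
def pert (ω : R.Ω) : Fin K → ℕ → Vec n := fun i k => R.δ i k ω

/-- The event that the states up to time `t` follow `j` and the noises lie in the sets `B`. -/
def path (t : ℕ) (j : ℕ → Fin K) (B : ℕ → Set (Vec n)) : Set R.Ω :=
  {ω | ∀ r ≤ t, R.s r ω = j r} ∩ {ω | ∀ r < t, R.w (r + 1) ω ∈ B (r + 1)}

theorem measurable_obs (t : ℕ) : Measurable (R.obs t) := (R.meas_s t).prodMk (R.meas_w t)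

theorem measurable_pert : Measurable R.pert :=
  measurable_pi_lambda _ fun i => measurable_pi_lambda _ fun k => R.meas_δ i k

/-- The states and the noise. -/
def sys (ω : R.Ω) : (ℕ → Fin K) × (ℕ → Vec n) := (fun t => R.s t ω, fun t => R.w t ω)

theorem measurable_sys : Measurable R.sys :=
  (measurable_pi_lambda _ fun t => R.meas_s t).prodMk (measurable_pi_lambda _ fun t => R.meas_w t)

theorem indepFun_pert_sys : IndepFun R.pert R.sys R.μ := R.δ_indep_system

theorem measurableSet_path (t : ℕ) (j : ℕ → Fin K) {B : ℕ → Set (Vec n)}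
    (hB : ∀ r, MeasurableSet (B r)) : MeasurableSet (R.path t j B) := by
  refine MeasurableSet.inter ?_ ?_
  · simp only [Set.ofPred_forall]
    exact MeasurableSet.iInter fun r => MeasurableSet.iInter fun _ =>
      R.meas_s r (measurableSet_singleton (j r))
  · simp only [Set.ofPred_forall]
    exact MeasurableSet.iInter fun r => MeasurableSet.iInter fun _ => R.meas_w (r + 1) (hB _)

/-- Splitting by the next state turns the event into disjoint paths one step longer, and the
quotient of consecutive products in `R.law` is one transition of `I.next`. -/
theorem measure_path_inter (t : ℕ) (j : ℕ → Fin K) {B : ℕ → Set (Vec n)}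
    (hB : ∀ r, MeasurableSet (B r)) {V : Set (Fin K × Vec n)} (hV : MeasurableSet V) :
    R.μ (R.path t j B ∩ R.obs (t + 1) ⁻¹' V) = R.μ (R.path t j B) * I.next (j t) V := by
  have hVj : ∀ j', MeasurableSet (Prod.mk j' ⁻¹' V : Set (Vec n)) := fun j' =>
    measurable_prodMk_left hV
  have hset : R.path t j B ∩ R.obs (t + 1) ⁻¹' V = ⋃ j', R.path (t + 1)
      (Function.update j (t + 1) j') (Function.update B (t + 1) (Prod.mk j' ⁻¹' V)) := by
    ext ω
    simp only [path, Set.mem_inter_iff, Set.mem_ofPred_eq, Set.mem_preimage, Set.mem_iUnion, obs]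
    constructor
    · rintro ⟨⟨h1, h2⟩, h3⟩
      refine ⟨R.s (t + 1) ω, fun r hr => ?_, fun r hr => ?_⟩
      · rcases eq_or_ne r (t + 1) with rfl | hne
        · simp
        · rw [Function.update_of_ne hne]; exact h1 r (by omega)
      · rcases eq_or_ne r t with rfl | hne
        · simpa using h3
        · rw [Function.update_of_ne (by omega)]; exact h2 r (by omega)
    · rintro ⟨j', h1, h2⟩
      have h0 := h1 (t + 1) le_rfl
      rw [Function.update_self] at h0
      refine ⟨⟨fun r hr => ?_, fun r hr => ?_⟩, ?_⟩
      · have := h1 r (by omega)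
        rwa [Function.update_of_ne (by omega)] at this
      · have := h2 r (by omega)
        rwa [Function.update_of_ne (by omega)] at this
      · have := h2 t (by omega)
        rw [Function.update_self] at this
        rw [h0]
        exact this
  have hBu : ∀ j' r, MeasurableSet (Function.update B (t + 1) (Prod.mk j' ⁻¹' V) r) := by
    intro j' r
    rcases eq_or_ne r (t + 1) with rfl | hne
    · rw [Function.update_self]; exact hVj j'
    · rw [Function.update_of_ne hne]; exact hB r
  rw [hset, measure_iUnion _ fun j' => R.measurableSet_path _ _ (hBu j'), tsum_fintype,
    I.next_apply _ hV, Finset.mul_sum]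
  · refine Finset.sum_congr rfl fun j' _ => ?_
    rw [path, path, R.law (t + 1) _ _ (hBu j'), R.law t j B hB, Finset.prod_range_succ, mul_assoc,
      Function.update_of_ne (by omega)]
    congr 2
    · refine Finset.prod_congr rfl fun r hr => ?_
      have := Finset.mem_range.1 hr
      rw [Function.update_of_ne (by omega), Function.update_of_ne (by omega),
        Function.update_of_ne (by omega)]
    · rw [Function.update_of_ne (by omega), Function.update_self, Function.update_self]
  · intro j₁ j₂ hne
    rw [Function.onFun, Set.disjoint_left]
    rintro ω ⟨h1, -⟩ ⟨h2, -⟩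
    have e1 := h1 (t + 1) le_rfl
    have e2 := h2 (t + 1) le_rfl
    rw [Function.update_self] at e1 e2
    exact hne (e1.symm.trans e2)

/-- The events that generate the information available before stage `t + 1`, together with all
perturbation vectors. -/
def histSets (t : ℕ) : Set (Set R.Ω) :=
  {E | ∃ X : Set (Fin K → ℕ → Vec n), MeasurableSet X ∧ ∃ (j : ℕ → Fin K) (B : ℕ → Set (Vec n)),
    (∀ r, MeasurableSet (B r)) ∧ E = R.pert ⁻¹' X ∩ R.path t j B}

/-- The information available before stage `t + 1`, together with all perturbation vectors. -/
abbrev hist (t : ℕ) : MeasurableSpace R.Ω := MeasurableSpace.generateFrom (R.histSets t)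

theorem measurableSet_of_mem_histSets {t : ℕ} {E : Set R.Ω} (hE : E ∈ R.histSets t) :
    MeasurableSet E := by
  obtain ⟨X, hX, j, B, hB, rfl⟩ := hE
  exact (R.measurable_pert hX).inter (R.measurableSet_path t j hB)

theorem hist_le (t : ℕ) : R.hist t ≤ R.mΩ :=
  MeasurableSpace.generateFrom_le fun _ hE => R.measurableSet_of_mem_histSets hE

/-- Two generators that meet have state paths agreeing up to time `t`, so their intersection is
again indexed by a single path. -/
theorem isPiSystem_histSets (t : ℕ) : IsPiSystem (R.histSets t) := by
  rintro _ ⟨X, hX, j, B, hB, rfl⟩ _ ⟨X', hX', j', B', hB', rfl⟩ ⟨ω₀, h1, h2⟩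
  refine ⟨X ∩ X', hX.inter hX', j, fun r => B r ∩ B' r, fun r => (hB r).inter (hB' r), ?_⟩
  have hj : ∀ r ≤ t, j r = j' r := fun r hr =>
    (h1.2.1 r hr).symm.trans (h2.2.1 r hr)
  ext ω
  simp only [path, Set.mem_inter_iff, Set.mem_preimage, Set.mem_ofPred_eq]
  constructor
  · rintro ⟨⟨a, b, c⟩, a', -, c'⟩
    exact ⟨⟨a, a'⟩, b, fun r hr => ⟨c r hr, c' r hr⟩⟩
  · rintro ⟨⟨a, a'⟩, b, c⟩
    exact ⟨⟨a, b, fun r hr => (c r hr).1⟩, a', fun r hr => (b r hr).trans (hj r hr),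
      fun r hr => (c r hr).2⟩

/-- Extension of a finite path by its initial value. -/
def extend {t : ℕ} (j : Fin (t + 1) → Fin K) (r : ℕ) : Fin K :=
  if h : r < t + 1 then j ⟨r, h⟩ else j 0

theorem mem_path_extend (t : ℕ) (ω : R.Ω) :
    ω ∈ R.path t (extend fun r : Fin (t + 1) => R.s r ω) fun _ => Set.univ := by
  refine ⟨fun r hr => ?_, fun r hr => Set.mem_univ _⟩
  simp [extend, Nat.lt_succ_of_le hr]

/-- Only finitely many state paths are possible up to time `t`, so measurability can be checked
after fixing the path, which is the shape of the generators. -/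
theorem measurableSet_hist_of_forall {t : ℕ} {E : Set R.Ω}
    (h : ∀ j : ℕ → Fin K, MeasurableSet[R.hist t] (E ∩ R.path t j fun _ => Set.univ)) :
    MeasurableSet[R.hist t] E := by
  have e : E = ⋃ j : Fin (t + 1) → Fin K, E ∩ R.path t (extend j) fun _ => Set.univ := by
    ext ω
    simp only [Set.mem_iUnion, Set.mem_inter_iff]
    exact ⟨fun hω => ⟨_, hω, R.mem_path_extend t ω⟩, fun ⟨_, hω, _⟩ => hω⟩
  rw [e]
  exact MeasurableSet.iUnion fun j => h _

theorem measurable_hist_s {t r : ℕ} (hr : r ≤ t) : Measurable[R.hist t] (R.s r) := by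
  intro S _
  refine R.measurableSet_hist_of_forall fun j => ?_
  by_cases hj : j r ∈ S
  · refine MeasurableSpace.measurableSet_generateFrom
      ⟨Set.univ, MeasurableSet.univ, j, fun _ => Set.univ, fun _ => MeasurableSet.univ, ?_⟩
    ext ω
    simp only [Set.mem_inter_iff, Set.mem_preimage, Set.mem_univ, true_and, and_iff_right_iff_imp]
    intro hω
    rw [hω.1 r hr]
    exact hj
  · convert @MeasurableSet.empty _ (R.hist t)
    ext ω
    simp only [Set.mem_inter_iff, Set.mem_preimage, Set.mem_empty_iff_false, iff_false, not_and]
    intro hω hp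
    rw [hp.1 r hr] at hω
    exact hj hω

theorem measurable_hist_w {t r : ℕ} (hr : r < t) : Measurable[R.hist t] (R.w (r + 1)) := by
  intro B hB
  refine R.measurableSet_hist_of_forall fun j => ?_
  refine MeasurableSpace.measurableSet_generateFrom
    ⟨Set.univ, MeasurableSet.univ, j, Function.update (fun _ => Set.univ) (r + 1) B, ?_, ?_⟩
  · intro q
    rcases eq_or_ne q (r + 1) with rfl | hne
    · rw [Function.update_self]; exact hB
    · rw [Function.update_of_ne hne]; exact MeasurableSet.univ
  · ext ω
    simp only [path, Set.mem_inter_iff, Set.mem_preimage, Set.mem_univ, true_and, Set.mem_ofPred_eq,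
      implies_true, and_true]
    constructor
    · rintro ⟨hω, h1⟩
      refine ⟨h1, fun q _ => ?_⟩
      rcases eq_or_ne q r with rfl | hne
      · rw [Function.update_self]; exact hω
      · rw [Function.update_of_ne (by omega)]; exact Set.mem_univ _
    · rintro ⟨h1, h2⟩
      have := h2 r hr
      rw [Function.update_self] at this
      exact ⟨this, h1⟩

theorem measurable_hist_pert (t : ℕ) : Measurable[R.hist t] R.pert := by
  intro X hX
  refine R.measurableSet_hist_of_forall fun j => ?_
  exact MeasurableSpace.measurableSet_generateFrom
    ⟨X, hX, j, fun _ => Set.univ, fun _ => MeasurableSet.univ, rfl⟩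

/-- Independence factors out the perturbation event from both sides, leaving the one-step path
identity. The current state is constant on a generator. -/
theorem measure_histSets_inter {t : ℕ} {E : Set R.Ω} (hE : E ∈ R.histSets t)
    {V : Set (Fin K × Vec n)} (hV : MeasurableSet V) :
    R.μ (E ∩ R.obs (t + 1) ⁻¹' V) = ∫⁻ ω in E, I.next (R.s t ω) V ∂(R.μ) := by
  have hEm := R.measurableSet_of_mem_histSets hE
  obtain ⟨X, hX, j, B, hB, rfl⟩ := hE
  have hpath : ∀ {F : Set R.Ω}, (∃ Y : Set ((ℕ → Fin K) × (ℕ → Vec n)), MeasurableSet Y ∧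
      F = R.sys ⁻¹' Y) → R.μ (R.pert ⁻¹' X ∩ F) = R.μ (R.pert ⁻¹' X) * R.μ F := by
    rintro F ⟨Y, hY, rfl⟩
    exact R.indepFun_pert_sys.measure_inter_preimage_eq_mul _ _ hX hY
  have hY : MeasurableSet ({q : (ℕ → Fin K) × (ℕ → Vec n) | ∀ r ≤ t, q.1 r = j r} ∩
      {q | ∀ r < t, q.2 (r + 1) ∈ B (r + 1)}) := by
    have hs : ∀ r, Measurable fun q : (ℕ → Fin K) × (ℕ → Vec n) => q.1 r := fun r =>
      (measurable_pi_apply r).comp measurable_fst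
    have hw : ∀ r, Measurable fun q : (ℕ → Fin K) × (ℕ → Vec n) => q.2 r := fun r =>
      (measurable_pi_apply r).comp measurable_snd
    refine MeasurableSet.inter ?_ ?_
    · simp only [Set.ofPred_forall]
      exact MeasurableSet.iInter fun r => MeasurableSet.iInter fun _ =>
        hs r (measurableSet_singleton (j r))
    · simp only [Set.ofPred_forall]
      exact MeasurableSet.iInter fun r => MeasurableSet.iInter fun _ => hw (r + 1) (hB _)
  have hYV : MeasurableSet {q : (ℕ → Fin K) × (ℕ → Vec n) | (q.1 (t + 1), q.2 (t + 1)) ∈ V} :=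
    (((measurable_pi_apply (t + 1)).comp measurable_fst).prodMk
      ((measurable_pi_apply (t + 1)).comp measurable_snd)) hV
  have h1 : R.μ (R.pert ⁻¹' X ∩ R.path t j B) = R.μ (R.pert ⁻¹' X) * R.μ (R.path t j B) :=
    hpath ⟨_, hY, rfl⟩
  have h2 : R.μ (R.pert ⁻¹' X ∩ (R.path t j B ∩ R.obs (t + 1) ⁻¹' V)) =
      R.μ (R.pert ⁻¹' X) * R.μ (R.path t j B ∩ R.obs (t + 1) ⁻¹' V) :=
    hpath ⟨_, hY.inter hYV, rfl⟩
  rw [Set.inter_assoc, h2, R.measure_path_inter t j hB hV, ← mul_assoc, ← h1]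
  rw [setLIntegral_congr_fun (g := fun _ => I.next (j t) V) hEm, setLIntegral_const, mul_comm]
  intro ω hω
  have : R.s t ω = j t := hω.2.1 t le_rfl
  simp only [this]

variable {p : MSPSA K n} {Θ : Set (Params K n)} {D : Set (Vec n)} {σw ξ₁ ξ₂ : ℝ}

/-- Both sides are finite measures of `E`, a restriction and a density, that agree on a π-system
generating `R.hist t`. Trimming to that σ-algebra lets the uniqueness theorem apply. -/
theorem measure_hist_inter {t : ℕ} {E : Set R.Ω}
    (hE : MeasurableSet[R.hist t] E) {V : Set (Fin K × Vec n)} (hV : MeasurableSet V) :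
    R.μ (E ∩ R.obs (t + 1) ⁻¹' V) = ∫⁻ ω in E, I.next (R.s t ω) V ∂(R.μ) := by
  have := R.prob
  have hN : MeasurableSet (R.obs (t + 1) ⁻¹' V) := R.measurable_obs (t + 1) hV
  have key : (R.μ.restrict (R.obs (t + 1) ⁻¹' V)).trim (R.hist_le t) =
      (R.μ.withDensity fun ω => I.next (R.s t ω) V).trim (R.hist_le t) := by
    refine @Measure.ext_of_generateFrom_of_cover_subset _ (R.hist t) _ _ (R.histSets t)
      (Set.range fun j : Fin (t + 1) → Fin K => R.path t (extend j) fun _ => Set.univ) rfl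
      (R.isPiSystem_histSets t) ?_ (Set.countable_range _) ?_ ?_ ?_
    · rintro _ ⟨j, rfl⟩
      exact ⟨Set.univ, MeasurableSet.univ, extend j, fun _ => Set.univ,
        fun _ => MeasurableSet.univ, by simp⟩
    · refine Set.eq_univ_of_forall fun ω => ?_
      exact ⟨_, ⟨_, rfl⟩, R.mem_path_extend t ω⟩
    · rintro _ ⟨j, rfl⟩
      exact measure_ne_top _ _
    · intro E hE
      have hEm := R.measurableSet_of_mem_histSets hE
      have hEh : MeasurableSet[R.hist t] E := MeasurableSpace.measurableSet_generateFrom hE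
      rw [trim_measurableSet_eq _ hEh, trim_measurableSet_eq _ hEh, Measure.restrict_apply hEm,
        withDensity_apply _ hEm, R.measure_histSets_inter hE hV]
  have hEm := R.hist_le t _ hE
  have := congrArg (fun m : @Measure R.Ω (R.hist t) => m E) key
  rwa [trim_measurableSet_eq _ hE, trim_measurableSet_eq _ hE, Measure.restrict_apply hEm,
    withDensity_apply _ hEm] at this

/-- The conditional law of the next state and noise, given the past. -/
theorem lintegral_next (h : I.Admissible Θ D σw) {β : Type*} [MeasurableSpace β] {t : ℕ}
    {Z : R.Ω → β} (hZ : Measurable[R.hist t] Z) {F : β × (Fin K × Vec n) → ℝ≥0∞}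
    (hF : Measurable F) :
    ∫⁻ ω, F (Z ω, R.obs (t + 1) ω) ∂(R.μ) =
      ∫⁻ ω, ∫⁻ z, F (Z ω, z) ∂(I.next (R.s t ω)) ∂(R.μ) := by
  have := R.prob
  have := h.isProbabilityMeasure_next
  let κ : Kernel R.Ω (Fin K × Vec n) :=
    ⟨fun ω => I.next (R.s t ω), (measurable_of_countable I.next).comp (R.meas_s t)⟩
  have : IsMarkovKernel κ := ⟨fun ω => h.isProbabilityMeasure_next (R.s t ω)⟩
  have hZ' : Measurable Z := hZ.mono (R.hist_le t) le_rfl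
  have hpair : Measurable fun q : R.Ω × (Fin K × Vec n) => (Z q.1, q.2) :=
    (hZ'.comp measurable_fst).prodMk measurable_snd
  have hpair' : Measurable fun ω => (Z ω, R.obs (t + 1) ω) :=
    hZ'.prodMk (R.measurable_obs (t + 1))
  have key : R.μ.map (fun ω => (Z ω, R.obs (t + 1) ω)) =
      (R.μ ⊗ₘ κ).map fun q => (Z q.1, q.2) := by
    have : IsFiniteMeasure (R.μ.map fun ω => (Z ω, R.obs (t + 1) ω)) :=
      Measure.isFiniteMeasure_map _ _
    refine Measure.ext_prod fun {U V} hU hV => ?_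
    rw [Measure.map_apply hpair' (hU.prod hV), Measure.map_apply hpair (hU.prod hV)]
    have e1 : (fun ω => (Z ω, R.obs (t + 1) ω)) ⁻¹' U ×ˢ V =
      Z ⁻¹' U ∩ R.obs (t + 1) ⁻¹' V := rfl
    have e2 : (fun q : R.Ω × (Fin K × Vec n) => (Z q.1, q.2)) ⁻¹' U ×ˢ V = (Z ⁻¹' U) ×ˢ V := rfl
    rw [e1, e2, R.measure_hist_inter (hZ hU) hV, Measure.compProd_apply_prod (hZ' hU) hV]
    rfl
  calc ∫⁻ ω, F (Z ω, R.obs (t + 1) ω) ∂(R.μ)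
      = ∫⁻ q, F q ∂(R.μ.map fun ω => (Z ω, R.obs (t + 1) ω)) := (lintegral_map hF hpair').symm
    _ = ∫⁻ q, F (Z q.1, q.2) ∂(R.μ ⊗ₘ κ) := by rw [key, lintegral_map hF hpair]
    _ = _ := Measure.lintegral_compProd (hF.comp hpair)

/-! ### Resampling a perturbation vector. -/

/-- Replacement of the perturbation vector with index `(i, k)`. -/
def replace (i : Fin K) (k : ℕ) (v : Fin n → ℝ) (d : Fin K → ℕ → Vec n) : Fin K → ℕ → Vec n :=
  fun i' k' => if (i', k') = (i, k) then WithLp.toLp 2 v else d i' k'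

theorem measurable_replace (i : Fin K) (k : ℕ) :
    Measurable fun q : (Fin n → ℝ) × (Fin K → ℕ → Vec n) => replace i k q.1 q.2 := by
  refine measurable_pi_lambda _ fun i' => measurable_pi_lambda _ fun k' => ?_
  unfold replace
  split_ifs
  · exact (WithLp.measurable_toLp 2 _).comp measurable_fst
  · exact (measurable_pi_apply k').comp ((measurable_pi_apply i').comp measurable_snd)

theorem replace_replace (i : Fin K) (k : ℕ) (v v' : Fin n → ℝ) (d : Fin K → ℕ → Vec n) :
    replace i k v (replace i k v' d) = replace i k v d := by
  funext i' k'
  unfold replace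
  split_ifs <;> rfl

theorem replace_self (i : Fin K) (k : ℕ) (d : Fin K → ℕ → Vec n) :
    replace i k (d i k).ofLp d = d := by
  funext i' k'
  unfold replace
  split_ifs with h
  · obtain ⟨rfl, rfl⟩ := Prod.mk.inj h
    rfl
  · rfl

/-- Blanking the block `(i, k)` with zeros leaves a function of the entries outside that block, and
disjoint families of independent entries generate independent σ-algebras. -/
theorem indepFun_replace (i : Fin K) (k : ℕ) :
    IndepFun (fun ω => (R.δ i k ω).ofLp) (fun ω => replace i k 0 (R.pert ω)) R.μ := by
  let X : Fin K × ℕ × Fin n → R.Ω → ℝ := fun q ω => R.δ q.1 q.2.1 ω q.2.2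
  have hX : ∀ q, Measurable (X q) := fun q =>
    (measurable_pi_apply q.2.2).comp ((WithLp.measurable_ofLp 2 _).comp (R.meas_δ q.1 q.2.1))
  let S : Set (Fin K × ℕ × Fin n) := {q | (q.1, q.2.1) = (i, k)}
  have hind := indep_iSup_of_disjoint (m := fun q => MeasurableSpace.comap (X q) inferInstance)
    (fun q => (hX q).comap_le) ((iIndepFun_iff_iIndep _ _ _).1 R.δ_indep)
    (disjoint_compl_right (a := S))
  rw [IndepFun_iff_Indep]
  refine indep_of_indep_of_le_left (indep_of_indep_of_le_right hind ?_) ?_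
  · rw [← measurable_iff_comap_le]
    refine @measurable_pi_lambda _ _ _ (_) _ _ fun i' => @measurable_pi_lambda _ _ _ (_) _ _ fun k' => ?_
    unfold replace
    split_ifs with h
    · exact measurable_const
    · refine (WithLp.measurable_toLp 2 _).comp (@measurable_pi_lambda _ _ _ (_) _ _ fun l => ?_)
      have hq : ((i', k', l) : Fin K × ℕ × Fin n) ∈ Sᶜ := h
      refine measurable_iff_comap_le.2 ?_
      exact le_iSup₂ (f := fun q (_ : q ∈ Sᶜ) => MeasurableSpace.comap (X q) inferInstance)
        (i', k', l) hq
  · rw [← measurable_iff_comap_le]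
    refine @measurable_pi_lambda _ _ _ (_) _ _ fun l => ?_
    have hq : ((i, k, l) : Fin K × ℕ × Fin n) ∈ S := rfl
    refine measurable_iff_comap_le.2 ?_
    exact le_iSup₂ (f := fun q (_ : q ∈ S) => MeasurableSpace.comap (X q) inferInstance)
      (i, k, l) hq

theorem map_pert_eq {p : MSPSA K n} (R : Realization I p.ν) (i : Fin K) (k : ℕ) :
    R.μ.map (fun ω => (R.δ i k ω).ofLp) = p.pertLaw := by
  have := R.prob
  have hind := R.δ_indep.precomp (g := fun l : Fin n => (i, k, l)) fun l l' h => by simpa using h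
  have hm : ∀ l, Measurable fun ω => R.δ i k ω l := fun l =>
    (measurable_pi_apply l).comp ((WithLp.measurable_ofLp 2 _).comp (R.meas_δ i k))
  have h := (iIndepFun_iff_map_fun_eq_pi_map fun l => (hm l).aemeasurable).1 hind
  simp only [R.δ_law] at h
  exact h

/-- The perturbation vector with index `(i, k)` can be replaced by an independent copy. -/
theorem lintegral_replace {p : MSPSA K n} (hp : p.Valid D ξ₁ ξ₂) (R : Realization I p.ν)
    (i : Fin K) (k : ℕ)
    {G : (Fin K → ℕ → Vec n) × ((ℕ → Fin K) × (ℕ → Vec n)) → ℝ≥0∞} (hG : Measurable G) :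
    ∫⁻ ω, G (R.pert ω, R.sys ω) ∂(R.μ) =
      ∫⁻ ω, ∫⁻ v, G (replace i k v (R.pert ω), R.sys ω) ∂p.pertLaw ∂(R.μ) := by
  have := R.prob
  have := hp.isProbabilityMeasure_pertLaw
  let d : R.Ω → Fin K → ℕ → Vec n := fun ω => replace i k 0 (R.pert ω)
  let u : R.Ω → Fin n → ℝ := fun ω => (R.δ i k ω).ofLp
  have hr : Measurable fun q : (Fin n → ℝ) × (Fin K → ℕ → Vec n) => replace i k q.1 q.2 :=
    measurable_replace i k
  have hu : Measurable u := (WithLp.measurable_ofLp 2 _).comp (R.meas_δ i k)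
  have hd : Measurable d := hr.comp (measurable_const.prodMk R.measurable_pert)
  have hs := R.measurable_sys
  -- The block is independent of the other blocks, and all blocks together are independent of states
  -- and noise; hence the block is independent of the remaining blocks and the system jointly.
  have hlaw : R.μ.map (fun ω => (u ω, d ω, R.sys ω)) =
      p.pertLaw.prod (R.μ.map fun ω => (d ω, R.sys ω)) := by
    have h1 := (indepFun_iff_map_prod_eq_prod_map_map hu.aemeasurable hd.aemeasurable).1
      (R.indepFun_replace i k)
    have h2 : IndepFun (fun ω => (u ω, d ω)) R.sys R.μ :=
      R.indepFun_pert_sys.comp (φ := fun a => ((a i k).ofLp, replace i k 0 a))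
        (((WithLp.measurable_ofLp 2 _).comp ((measurable_pi_apply k).comp
          (measurable_pi_apply i))).prodMk (hr.comp (measurable_const.prodMk measurable_id)))
        measurable_id
    have h2' := (indepFun_iff_map_prod_eq_prod_map_map (hu.prodMk hd).aemeasurable
      hs.aemeasurable).1 h2
    have h3 : IndepFun d R.sys R.μ :=
      R.indepFun_pert_sys.comp (φ := fun a => replace i k 0 a)
        (hr.comp (measurable_const.prodMk measurable_id)) measurable_id
    have h3' := (indepFun_iff_map_prod_eq_prod_map_map hd.aemeasurable hs.aemeasurable).1 h3
    have : SFinite (R.μ.map u) := inferInstance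
    rw [h3', ← map_pert_eq R i k, ← Measure.prodAssoc_prod, ← h1, ← h2',
      Measure.map_map MeasurableEquiv.prodAssoc.measurable ((hu.prodMk hd).prodMk hs)]
    rfl
  have hG' : Measurable fun q : (Fin n → ℝ) × ((Fin K → ℕ → Vec n) ×
      ((ℕ → Fin K) × (ℕ → Vec n))) => G (replace i k q.1 q.2.1, q.2.2) :=
    hG.comp ((hr.comp (measurable_fst.prodMk measurable_snd.fst)).prodMk measurable_snd.snd)
  calc ∫⁻ ω, G (R.pert ω, R.sys ω) ∂(R.μ)
      = ∫⁻ ω, G (replace i k (u ω) (d ω), R.sys ω) ∂(R.μ) := by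
        refine lintegral_congr fun ω => ?_
        have e : replace i k (u ω) (d ω) = R.pert ω := by
          simp only [d, replace_replace]
          exact replace_self i k (R.pert ω)
        rw [e]
    _ = ∫⁻ q, G (replace i k q.1 q.2.1, q.2.2) ∂(R.μ.map fun ω => (u ω, d ω, R.sys ω)) :=
        (lintegral_map hG' (hu.prodMk (hd.prodMk hs))).symm
    _ = ∫⁻ q, ∫⁻ v, G (replace i k v q.1, q.2) ∂p.pertLaw ∂(R.μ.map fun ω => (d ω, R.sys ω)) := by
        rw [hlaw, lintegral_prod_symm _ hG'.aemeasurable]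
    _ = ∫⁻ ω, ∫⁻ v, G (replace i k v (d ω), R.sys ω) ∂p.pertLaw ∂(R.μ) :=
        lintegral_map hG'.lintegral_prod_left' (hd.prodMk hs)
    _ = _ := by simp only [d, replace_replace]

end Realization

/-! ### The potential of a state and its change in one stage. -/

theorem enorm_add_sq_le {E : Type*} [SeminormedAddCommGroup E] (x y : E) :
    ‖x + y‖ₑ ^ 2 ≤ 2 * ‖x‖ₑ ^ 2 + 2 * ‖y‖ₑ ^ 2 := by
  have h : ‖x + y‖ ^ 2 ≤ 2 * ‖x‖ ^ 2 + 2 * ‖y‖ ^ 2 := by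
    have := pow_le_pow_left₀ (norm_nonneg _) (norm_add_le x y) 2
    nlinarith [sq_nonneg (‖x‖ - ‖y‖)]
  have h2 := ENNReal.ofReal_le_ofReal h
  rw [ENNReal.ofReal_add (by positivity) (by positivity), ENNReal.ofReal_mul zero_le_two,
    ENNReal.ofReal_mul zero_le_two, ENNReal.ofReal_pow (norm_nonneg _),
    ENNReal.ofReal_pow (norm_nonneg _), ENNReal.ofReal_pow (norm_nonneg _)] at h2
  simpa using h2

theorem lintegral_le_of_fiber {Ω ι : Type*} [MeasurableSpace Ω] {μ : Measure Ω} [Countable ι]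
    [MeasurableSpace ι] [MeasurableSingletonClass ι] {X : Ω → ι} (hX : Measurable X)
    {f g : Ω → ℝ≥0∞} (h : ∀ q, ∫⁻ ω in X ⁻¹' {q}, f ω ∂μ ≤ ∫⁻ ω in X ⁻¹' {q}, g ω ∂μ) :
    ∫⁻ ω, f ω ∂μ ≤ ∫⁻ ω, g ω ∂μ := by
  have hU : ⋃ q, X ⁻¹' {q} = Set.univ := by
    rw [← Set.preimage_iUnion, Set.iUnion_of_singleton, Set.preimage_univ]
  have hm : ∀ q, MeasurableSet (X ⁻¹' {q}) := fun q => hX (measurableSet_singleton q)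
  have hd : Pairwise (Function.onFun Disjoint fun q => X ⁻¹' {q}) := fun a b hab =>
    Disjoint.preimage _ (Set.disjoint_singleton.2 hab)
  rw [← setLIntegral_univ f, ← setLIntegral_univ g, ← hU, lintegral_iUnion hm hd,
    lintegral_iUnion hm hd]
  exact ENNReal.tsum_le_tsum h

namespace MSPSA

variable {K n : ℕ} (p : MSPSA K n) (D : Set (Vec n)) (I : Model K n)

/-- The expected square error of the next estimate for state `i`, given the stored cost `d` and
the perturbation vector `v`. -/
def nextErr (i : Fin K) (k : ℕ) (x : Vec n) (d : ℝ) (v : Fin n → ℝ) : ℝ≥0∞ :=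
  ∫⁻ z, ‖p.newEst D i k x d (I.obsCost (x - p.pertGain i k • WithLp.toLp 2 v) z) v -
    I.optInput i‖ₑ ^ 2 ∂(I.next i)

/-- The expected square error of the next estimate for state `i`, given the perturbation vector. -/
def pairErr (i : Fin K) (k : ℕ) (x : Vec n) (v : Fin n → ℝ) : ℝ≥0∞ :=
  ∫⁻ z, p.nextErr D I i k x (I.obsCost (x + p.pertGain i k • WithLp.toLp 2 v) z) v ∂(I.next i)

/-- A bound on the expected future cost of the visits to state `i`, given the memory. -/
def potential (α ρ η : Fin K → ℕ → ℝ≥0∞) (m : Memory K n) (δ : Fin K → ℕ → Vec n)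
    (i : Fin K) : ℝ≥0∞ :=
  if m.flag i = true then
    2 * ‖m.est i - I.optInput i‖ₑ ^ 2 + η i (m.count i) + (α i (m.count i) *
      p.nextErr D I i (m.count i) (m.est i) (m.dPlus i) (δ i (m.count i)).ofLp +
      ρ i (m.count i))
  else α i (m.count i) * ‖m.est i - I.optInput i‖ₑ ^ 2 + ρ i (m.count i)

variable {p D I} {Θ : Set (Params K n)} {σw ξ₁ ξ₂ : ℝ} {α ρ η q β : Fin K → ℕ → ℝ≥0∞}

theorem measurable_nextErr (h : I.Admissible Θ D σw) (hD : Measurable (euclProj D)) (i : Fin K)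
    (k : ℕ) {A : Type*} [MeasurableSpace A] {x : A → Vec n} {d : A → ℝ} {v : A → Fin n → ℝ}
    (hx : Measurable x) (hd : Measurable d) (hv : Measurable v) :
    Measurable fun a => p.nextErr D I i k (x a) (d a) (v a) := by
  have := h.isProbabilityMeasure_next i
  unfold nextErr
  refine Measurable.lintegral_prod_right' (f := fun r : A × (Fin K × Vec n) =>
    ‖p.newEst D i k (x r.1) (d r.1) (I.obsCost (x r.1 - p.pertGain i k • WithLp.toLp 2 (v r.1)) r.2)
      (v r.1) - I.optInput i‖ₑ ^ 2) ?_
  have hx' : Measurable fun r : A × (Fin K × Vec n) => x r.1 := hx.comp measurable_fst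
  have hd' : Measurable fun r : A × (Fin K × Vec n) => d r.1 := hd.comp measurable_fst
  have hv' : Measurable fun r : A × (Fin K × Vec n) => v r.1 := hv.comp measurable_fst
  have hL : Measurable fun r : A × (Fin K × Vec n) => (WithLp.toLp 2 (v r.1) : Vec n) :=
    (WithLp.measurable_toLp 2 _).comp hv'
  have hc := Measurable.obsCost (I := I) (hx'.sub (hL.const_smul_vec (p.pertGain i k)))
    measurable_snd
  exact (((p.measurable_newEst hD i k hx' hd' hc hv').sub_const _).enorm).pow_const 2

theorem measurable_pairErr (h : I.Admissible Θ D σw) (hD : Measurable (euclProj D)) (i : Fin K)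
    (k : ℕ) {A : Type*} [MeasurableSpace A] {x : A → Vec n} {v : A → Fin n → ℝ}
    (hx : Measurable x) (hv : Measurable v) :
    Measurable fun a => p.pairErr D I i k (x a) (v a) := by
  have := h.isProbabilityMeasure_next i
  unfold pairErr
  refine Measurable.lintegral_prod_right' (f := fun r : A × (Fin K × Vec n) =>
    p.nextErr D I i k (x r.1) (I.obsCost (x r.1 + p.pertGain i k • WithLp.toLp 2 (v r.1)) r.2)
      (v r.1)) ?_
  have hx' : Measurable fun r : A × (Fin K × Vec n) => x r.1 := hx.comp measurable_fst
  have hv' : Measurable fun r : A × (Fin K × Vec n) => v r.1 := hv.comp measurable_fst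
  have hL : Measurable fun r : A × (Fin K × Vec n) => (WithLp.toLp 2 (v r.1) : Vec n) :=
    (WithLp.measurable_toLp 2 _).comp hv'
  have hc := Measurable.obsCost (I := I) (hx'.add (hL.const_smul_vec (p.pertGain i k)))
    measurable_snd
  exact measurable_nextErr h hD i k hx' hc hv'

theorem measurable_potential (h : I.Admissible Θ D σw) (hD : Measurable (euclProj D)) {A : Type*}
    [MeasurableSpace A] {m : A → Memory K n} {δ : A → Fin K → ℕ → Vec n} (hm : Measurable m)
    (hδ : Measurable δ) (i : Fin K) :
    Measurable fun a => p.potential D I α ρ η (m a) (δ a) i := by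
  have hc : Measurable fun a => (m a).count i := (measurable_count i).comp hm
  have hf : Measurable fun a => (m a).flag i := (measurable_flag i).comp hm
  have he : Measurable fun a => (m a).est i := (measurable_est i).comp hm
  have hd : Measurable fun a => (m a).dPlus i := (measurable_dPlus i).comp hm
  have he2 : Measurable fun a => ‖(m a).est i - I.optInput i‖ₑ ^ 2 :=
    ((he.sub_const _).enorm).pow_const 2
  have hs : ∀ σ : ℕ → ℝ≥0∞, Measurable fun a => σ ((m a).count i) := fun σ =>
    (measurable_of_countable σ).comp hc
  have hn : Measurable fun a => p.nextErr D I i ((m a).count i) ((m a).est i) ((m a).dPlus i)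
      (δ a i ((m a).count i)).ofLp := by
    refine Measurable.apply_countable (F := fun k a => p.nextErr D I i k ((m a).est i)
      ((m a).dPlus i) (δ a i k).ofLp) (fun k => ?_) hc
    refine measurable_nextErr h hD i k he hd ?_
    exact (WithLp.measurable_ofLp 2 _).comp
      ((measurable_pi_apply k).comp ((measurable_pi_apply i).comp hδ))
  unfold potential
  refine Measurable.ite (hf (measurableSet_singleton true)) ?_ ?_
  · exact ((he2.const_mul 2).add (hs (η i))).add (((hs (α i)).mul hn).add (hs (ρ i)))
  · exact ((hs (α i)).mul he2).add (hs (ρ i))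

/-- The expected potential of state `i` after a stage that starts in state `i`. -/
def potentialAfter (p : MSPSA K n) (D : Set (Vec n)) (I : Model K n) (α ρ η : Fin K → ℕ → ℝ≥0∞)
    (m : Memory K n) (δ : Fin K → ℕ → Vec n) (i : Fin K) : ℝ≥0∞ :=
  ∫⁻ z, p.potential D I α ρ η
    (p.update D m δ i (I.output z.1 (p.input m δ i) z.2)) δ i ∂(I.next i)

theorem enorm_input_sub_sq_le (hη : ∀ i k (v : Vec n), (∀ l, |v l| ≤ ξ₁) →
      2 * ‖p.pertGain i k • v‖ₑ ^ 2 ≤ η i k) {δ : Fin K → ℕ → Vec n}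
    (hδ : ∀ i k l, |δ i k l| ≤ ξ₁) (m : Memory K n) (i : Fin K) :
    ‖p.input m δ i - I.optInput i‖ₑ ^ 2 ≤ 2 * ‖m.est i - I.optInput i‖ₑ ^ 2 +
      if m.flag i = true then η i (m.count i) else η i (m.count i + 1) := by
  cases hf : m.flag i
  · rw [p.input_of_flag_false hf, add_sub_right_comm]
    refine (enorm_add_sq_le _ _).trans ?_
    simp only [Bool.false_eq_true, if_false]
    gcongr
    exact hη _ _ _ (hδ _ _)
  · rw [p.input_of_flag_true hf, sub_right_comm, sub_eq_add_neg (m.est i - I.optInput i)]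
    refine (enorm_add_sq_le _ _).trans ?_
    rw [enorm_neg]
    simp only [if_true]
    gcongr
    exact hη _ _ _ (hδ _ _)

/-- At the second visit of a pair the potential already contains the cost bound `2 ‖e‖² + η` for
this visit and the expected weighted error of the next estimate. The decrease needs no averaging
over perturbations. -/
theorem enorm_input_add_potentialAfter_le_of_true (h : I.Admissible Θ D σw)
    (hD : Measurable (euclProj D))
    (hη : ∀ i k (v : Vec n), (∀ l, |v l| ≤ ξ₁) → 2 * ‖p.pertGain i k • v‖ₑ ^ 2 ≤ η i k)
    {δ : Fin K → ℕ → Vec n} (hδ : ∀ i k l, |δ i k l| ≤ ξ₁) {m : Memory K n} {i : Fin K}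
    (hf : m.flag i = true) :
    ‖p.input m δ i - I.optInput i‖ₑ ^ 2 + p.potentialAfter D I α ρ η m δ i ≤
      p.potential D I α ρ η m δ i := by
  have := h.isProbabilityMeasure_next i
  have h1 := enorm_input_sub_sq_le (I := I) hη hδ m i
  rw [if_pos hf] at h1
  have h2 : p.potentialAfter D I α ρ η m δ i = α i (m.count i) *
      p.nextErr D I i (m.count i) (m.est i) (m.dPlus i) (δ i (m.count i)).ofLp +
      ρ i (m.count i) := by
    have hmeas : Measurable fun z : Fin K × Vec n => ‖p.newEst D i (m.count i) (m.est i) (m.dPlus i)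
        (I.obsCost (m.est i - p.pertGain i (m.count i) • WithLp.toLp 2 (δ i (m.count i)).ofLp) z)
        (δ i (m.count i)).ofLp - I.optInput i‖ₑ ^ 2 :=
      (((p.measurable_newEst hD i _ measurable_const measurable_const
        (Measurable.obsCost measurable_const measurable_id) measurable_const).sub_const _).enorm
        ).pow_const 2
    rw [nextErr, ← lintegral_const_mul _ hmeas, potentialAfter]
    have e : ∀ z : Fin K × Vec n, p.potential D I α ρ η
        (p.update D m δ i (I.output z.1 (p.input m δ i) z.2)) δ i =
        α i (m.count i) * ‖p.newEst D i (m.count i) (m.est i) (m.dPlus i)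
        (I.obsCost (m.est i - p.pertGain i (m.count i) • WithLp.toLp 2 (δ i (m.count i)).ofLp) z)
        (δ i (m.count i)).ofLp - I.optInput i‖ₑ ^ 2 + ρ i (m.count i) := by
      intro z
      rw [p.update_of_flag_true D hf, p.input_of_flag_true hf, potential]
      simp only [Function.update_self, Bool.false_eq_true, if_false]
      rfl
    simp only [e]
    rw [lintegral_add_left (hmeas.const_mul _), lintegral_const, measure_univ, mul_one]
  rw [h2, potential, if_pos hf]
  gcongr

/-- At the first visit, both visits of the new pair are charged `2 ‖e‖² + η` each, which explains
the factors `4` and `2`. The perturbation vector is still fixed here; averaging over it comes later.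
-/
theorem enorm_input_add_potentialAfter_le_of_false (h : I.Admissible Θ D σw)
    (hD : Measurable (euclProj D))
    (hη : ∀ i k (v : Vec n), (∀ l, |v l| ≤ ξ₁) → 2 * ‖p.pertGain i k • v‖ₑ ^ 2 ≤ η i k)
    {δ : Fin K → ℕ → Vec n} (hδ : ∀ i k l, |δ i k l| ≤ ξ₁) {m : Memory K n} {i : Fin K}
    (hf : m.flag i = false) :
    ‖p.input m δ i - I.optInput i‖ₑ ^ 2 + p.potentialAfter D I α ρ η m δ i ≤
      4 * ‖m.est i - I.optInput i‖ₑ ^ 2 + (2 * η i (m.count i + 1) + ρ i (m.count i + 1)) +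
      α i (m.count i + 1) * p.pairErr D I i (m.count i + 1) (m.est i)
        (δ i (m.count i + 1)).ofLp := by
  have := h.isProbabilityMeasure_next i
  have h1 := enorm_input_sub_sq_le (I := I) hη hδ m i
  rw [if_neg (by simp [hf])] at h1
  set k := m.count i + 1 with hk
  have h2 : p.potentialAfter D I α ρ η m δ i = 2 * ‖m.est i - I.optInput i‖ₑ ^ 2 + η i k +
      (α i k * p.pairErr D I i k (m.est i) (δ i k).ofLp + ρ i k) := by
    have hmeas : Measurable fun z : Fin K × Vec n => p.nextErr D I i k (m.est i)
        (I.obsCost (m.est i + p.pertGain i k • WithLp.toLp 2 (δ i k).ofLp) z) (δ i k).ofLp :=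
      measurable_nextErr h hD i k measurable_const
        (Measurable.obsCost measurable_const measurable_id) measurable_const
    rw [pairErr, ← lintegral_const_mul _ hmeas, potentialAfter]
    have e : ∀ z : Fin K × Vec n, p.potential D I α ρ η
        (p.update D m δ i (I.output z.1 (p.input m δ i) z.2)) δ i =
        (2 * ‖m.est i - I.optInput i‖ₑ ^ 2 + η i k) + (α i k * p.nextErr D I i k (m.est i)
        (I.obsCost (m.est i + p.pertGain i k • WithLp.toLp 2 (δ i k).ofLp) z) (δ i k).ofLp +
        ρ i k) := by
      intro z
      rw [p.update_of_flag_false D hf, p.input_of_flag_false hf, potential]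
      simp only [Function.update_self, if_true]
      rfl
    simp only [e]
    rw [lintegral_add_left measurable_const, lintegral_add_left (hmeas.const_mul _),
      lintegral_const, lintegral_const, measure_univ, mul_one, mul_one]
  rw [h2]
  refine (add_le_add_left h1 _).trans (le_of_eq ?_)
  ring

end MSPSA

/-! ### Decrease of the expected potential and telescoping. -/

namespace Realization

variable {K n : ℕ} {p : MSPSA K n} {I : Model K n} {Θ : Set (Params K n)} {D : Set (Vec n)}
  {σw ξ₁ ξ₂ : ℝ} {α ρ η q β : Fin K → ℕ → ℝ≥0∞}

/-- The memory of MSPSA after `t` stages. -/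
def mem (R : Realization I p.ν) (D : Set (Vec n)) (t : ℕ) (ω : R.Ω) : MSPSA.Memory K n :=
  p.memory D I (fun r => R.s r ω) (fun r => R.w r ω) (R.pert ω) t

theorem measurable_hist_mem (R : Realization I p.ν) (hD : Measurable (euclProj D)) (t : ℕ) :
    Measurable[R.hist t] (R.mem D t) := by
  have hδ : ∀ i k, Measurable[R.hist t] (R.δ i k) := fun i k =>
    (measurable_pi_apply k).comp ((measurable_pi_apply i).comp (R.measurable_hist_pert t))
  exact @MSPSA.measurable_memory K n R.Ω (R.hist t) p R.δ D hD I R.s R.w hδ t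
    (fun r hr => R.measurable_hist_s hr) (fun r hr => R.measurable_hist_w hr)

theorem measurable_mem (R : Realization I p.ν) (hD : Measurable (euclProj D)) (t : ℕ) :
    Measurable (R.mem D t) := (R.measurable_hist_mem hD t).mono (R.hist_le t) le_rfl

theorem input_eq (R : Realization I p.ν) (D : Set (Vec n)) (t : ℕ) (ω : R.Ω) :
    R.input D t ω = p.input (R.mem D t ω) (R.pert ω) (R.s t ω) := rfl

theorem mem_succ (R : Realization I p.ν) (D : Set (Vec n)) (t : ℕ) (ω : R.Ω) :
    R.mem D (t + 1) ω = p.update D (R.mem D t ω) (R.pert ω) (R.s t ω)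
      (I.output (R.obs (t + 1) ω).1 (p.input (R.mem D t ω) (R.pert ω) (R.s t ω))
        (R.obs (t + 1) ω).2) := rfl

theorem measurable_input (R : Realization I p.ν) (hD : Measurable (euclProj D)) (t : ℕ) :
    Measurable (R.input D t) :=
  p.measurable_input (R.measurable_mem hD t) R.meas_δ (R.meas_s t)

theorem ae_abs_pert_le (R : Realization I p.ν) (hp : p.Valid D ξ₁ ξ₂) :
    ∀ᵐ ω ∂(R.μ), ∀ i k l, |R.pert ω i k l| ≤ ξ₁ := by
  simp only [ae_all_iff]
  intro i k l
  have hm : Measurable fun ω => R.δ i k ω l :=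
    (measurable_pi_apply l).comp ((WithLp.measurable_ofLp 2 _).comp (R.meas_δ i k))
  have h := hp.ν_bdd
  rw [← R.δ_law i k l] at h
  exact ae_of_ae_map hm.aemeasurable h

/-- Resampling of the next perturbation vector for state `i`. -/
theorem setLIntegral_pairErr (R : Realization I p.ν) (hp : p.Valid D ξ₁ ξ₂)
    (h : I.Admissible Θ D σw) (hD : Measurable (euclProj D)) (t : ℕ) (i : Fin K) (k : ℕ) :
    ∫⁻ ω in {ω | R.s t ω = i ∧ (R.mem D t ω).flag i = false ∧ (R.mem D t ω).count i = k},
        p.pairErr D I i (k + 1) ((R.mem D t ω).est i) (R.δ i (k + 1) ω).ofLp ∂(R.μ) =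
      ∫⁻ ω in {ω | R.s t ω = i ∧ (R.mem D t ω).flag i = false ∧ (R.mem D t ω).count i = k},
        ∫⁻ v, p.pairErr D I i (k + 1) ((R.mem D t ω).est i) v ∂p.pertLaw ∂(R.μ) := by
  classical
  let S := (Fin K → ℕ → Vec n) × ((ℕ → Fin K) × (ℕ → Vec n))
  let M : S → MSPSA.Memory K n := fun a => p.memory D I a.2.1 a.2.2 a.1 t
  have hM : Measurable M := by
    refine p.measurable_memory (s := fun r (a : S) => a.2.1 r) (w := fun r (a : S) => a.2.2 r)
      (δ := fun i k (a : S) => a.1 i k) hD I (fun i k => ?_) t (fun r _ => ?_) (fun r _ => ?_)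
    · exact (measurable_pi_apply k).comp ((measurable_pi_apply i).comp measurable_fst)
    · exact (measurable_pi_apply r).comp measurable_snd.fst
    · exact (measurable_pi_apply (r + 1)).comp measurable_snd.snd
  let P : S → Prop := fun a => a.2.1 t = i ∧ (M a).flag i = false ∧ (M a).count i = k
  have hP : MeasurableSet {a | P a} := by
    have h1 : Measurable fun a : S => a.2.1 t := (measurable_pi_apply t).comp measurable_snd.fst
    have h2 : Measurable fun a : S => (M a).flag i := (MSPSA.measurable_flag i).comp hM
    have h3 : Measurable fun a : S => (M a).count i := (MSPSA.measurable_count i).comp hM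
    exact (h1 (measurableSet_singleton i)).inter
      ((h2 (measurableSet_singleton false)).inter (h3 (measurableSet_singleton k)))
  let G : S → ℝ≥0∞ := fun a =>
    if P a then p.pairErr D I i (k + 1) ((M a).est i) (a.1 i (k + 1)).ofLp else 0
  have hG : Measurable G := by
    refine Measurable.ite hP (MSPSA.measurable_pairErr h hD i (k + 1)
      ((MSPSA.measurable_est i).comp hM) ?_) measurable_const
    exact (WithLp.measurable_ofLp 2 _).comp ((measurable_pi_apply (k + 1)).comp
      ((measurable_pi_apply i).comp measurable_fst))
  have hA : MeasurableSet {ω | P (R.pert ω, R.sys ω)} :=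
    (R.measurable_pert.prodMk R.measurable_sys) hP
  -- With counter value `k`, vector `k + 1` is unused, so replacing it changes neither the memory
  -- nor the event. The counter is known on only one side at a time, so `memory_congr` is applied in
  -- both directions.
  have hrep : ∀ (ω : R.Ω) (v : Fin n → ℝ), G (replace i (k + 1) v (R.pert ω), R.sys ω) =
      if P (R.pert ω, R.sys ω) then
        p.pairErr D I i (k + 1) ((M (R.pert ω, R.sys ω)).est i) v else 0 := by
    intro ω v
    have hne : ∀ i' k', (i', k') ≠ (i, k + 1) →
        replace i (k + 1) v (R.pert ω) i' k' = R.pert ω i' k' := fun i' k' hik => if_neg hik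
    have hself : replace i (k + 1) v (R.pert ω) i (k + 1) = WithLp.toLp 2 v := if_pos rfl
    by_cases hPω : P (R.pert ω, R.sys ω)
    · have e : M (R.pert ω, R.sys ω) = M (replace i (k + 1) v (R.pert ω), R.sys ω) :=
        p.memory_congr D I _ _ (fun i' k' hik => (hne i' k' hik).symm) t
          (lt_of_eq_of_lt hPω.2.2 (Nat.lt_succ_self k))
      have hP' : P (replace i (k + 1) v (R.pert ω), R.sys ω) := by
        simp only [P] at hPω ⊢
        rw [← e]
        exact hPω
      simp only [G, if_pos hPω, if_pos hP', ← e, hself]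
    · have hP' : ¬P (replace i (k + 1) v (R.pert ω), R.sys ω) := by
        intro hP'
        have e : M (replace i (k + 1) v (R.pert ω), R.sys ω) = M (R.pert ω, R.sys ω) :=
          p.memory_congr D I _ _ hne t
            (lt_of_eq_of_lt hP'.2.2 (Nat.lt_succ_self k))
        apply hPω
        simp only [P] at hP' ⊢
        rw [← e]
        exact hP'
      simp only [G, if_neg hPω, if_neg hP']
  have key := R.lintegral_replace hp i (k + 1) hG
  simp only [hrep] at key
  have e1 : ∀ ω, G (R.pert ω, R.sys ω) = Set.indicator {ω | P (R.pert ω, R.sys ω)}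
      (fun ω => p.pairErr D I i (k + 1) ((R.mem D t ω).est i) (R.δ i (k + 1) ω).ofLp) ω := by
    intro ω
    by_cases hPω : P (R.pert ω, R.sys ω)
    · rw [Set.indicator_of_mem (show ω ∈ {ω | P (R.pert ω, R.sys ω)} from hPω)]
      exact if_pos hPω
    · rw [Set.indicator_of_notMem (show ω ∉ {ω | P (R.pert ω, R.sys ω)} from hPω)]
      exact if_neg hPω
  have e2 : ∀ ω, ∫⁻ v, (if P (R.pert ω, R.sys ω) then
        p.pairErr D I i (k + 1) ((M (R.pert ω, R.sys ω)).est i) v else 0) ∂p.pertLaw =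
      Set.indicator {ω | P (R.pert ω, R.sys ω)}
        (fun ω => ∫⁻ v, p.pairErr D I i (k + 1) ((R.mem D t ω).est i) v ∂p.pertLaw) ω := by
    intro ω
    by_cases hPω : P (R.pert ω, R.sys ω)
    · rw [Set.indicator_of_mem (show ω ∈ {ω | P (R.pert ω, R.sys ω)} from hPω)]
      simp only [if_pos hPω]
      rfl
    · rw [Set.indicator_of_notMem (show ω ∉ {ω | P (R.pert ω, R.sys ω)} from hPω)]
      simp [if_neg hPω]
  simp only [e1, e2] at key
  rwa [lintegral_indicator hA, lintegral_indicator hA] at key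

end Realization

namespace MSPSA

/-- The potentials of unvisited states cancel exactly, which is why random visit times cause no
trouble. -/
theorem potential_update_of_ne {K n : ℕ} (p : MSPSA K n) (D : Set (Vec n)) (I : Model K n)
    (α ρ η : Fin K → ℕ → ℝ≥0∞) (m : Memory K n) (δ : Fin K → ℕ → Vec n) {i j : Fin K}
    (hj : j ≠ i) (y : Vec n) :
    p.potential D I α ρ η (p.update D m δ i y) δ j = p.potential D I α ρ η m δ j := by
  cases hf : m.flag i
  · rw [p.update_of_flag_false D hf]
    simp only [potential, Function.update_of_ne hj]
  · rw [p.update_of_flag_true D hf]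
    simp only [potential, Function.update_of_ne hj]

end MSPSA

namespace Realization

variable {K n : ℕ} {p : MSPSA K n} {I : Model K n} {Θ : Set (Params K n)} {D : Set (Vec n)}
  {σw ξ₁ ξ₂ : ℝ} {α ρ η q β : Fin K → ℕ → ℝ≥0∞}

/-- State, flag and counter take countably many values, so the inequality is proved on each fiber.
With the flag down, resampling the unused vector turns `pairErr` into `q ‖e‖² + β`, and `hα`, `hρ`
are exactly what makes the collected coefficients fit into the old potential. With the flag up the
inequality holds almost surely. -/
theorem lintegral_cost_add_potentialAfter_le (R : Realization I p.ν) (hp : p.Valid D ξ₁ ξ₂)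
    (h : I.Admissible Θ D σw) (hDc : IsCompact D) (hD : Measurable (euclProj D)) {T t : ℕ}
    (ht : t < T)
    (hα : ∀ i, ∀ k < T, 4 + q i (k + 1) * α i (k + 1) ≤ α i k)
    (hρ : ∀ i, ∀ k < T, 2 * η i (k + 1) + α i (k + 1) * β i (k + 1) + ρ i (k + 1) ≤ ρ i k)
    (hη : ∀ i k (v : Vec n), (∀ l, |v l| ≤ ξ₁) → 2 * ‖p.pertGain i k • v‖ₑ ^ 2 ≤ η i k)
    (hpair : ∀ i k, ∀ x ∈ D, ∫⁻ v, p.pairErr D I i (k + 1) x v ∂p.pertLaw ≤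
      q i (k + 1) * ‖x - I.optInput i‖ₑ ^ 2 + β i (k + 1)) :
    ∫⁻ ω, (‖R.input D t ω - I.optInput (R.s t ω)‖ₑ ^ 2 +
        p.potentialAfter D I α ρ η (R.mem D t ω) (R.pert ω) (R.s t ω)) ∂(R.μ) ≤
      ∫⁻ ω, p.potential D I α ρ η (R.mem D t ω) (R.pert ω) (R.s t ω) ∂(R.μ) := by
  have hm := R.measurable_mem hD t
  have hs := R.meas_s t
  have hflag : Measurable fun ω => (R.mem D t ω).flag (R.s t ω) :=
    Measurable.apply_countable (F := fun i ω => (R.mem D t ω).flag i)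
      (fun i => (MSPSA.measurable_flag i).comp hm) hs
  have hcount : Measurable fun ω => (R.mem D t ω).count (R.s t ω) :=
    Measurable.apply_countable (F := fun i ω => (R.mem D t ω).count i)
      (fun i => (MSPSA.measurable_count i).comp hm) hs
  refine lintegral_le_of_fiber (X := fun ω =>
    (R.s t ω, (R.mem D t ω).flag (R.s t ω), (R.mem D t ω).count (R.s t ω)))
    (hs.prodMk (hflag.prodMk hcount)) ?_
  rintro ⟨i, b, k⟩
  set A := (fun ω => (R.s t ω, (R.mem D t ω).flag (R.s t ω), (R.mem D t ω).count (R.s t ω))) ⁻¹'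
    {(i, b, k)} with hAdef
  have hA : MeasurableSet A := (hs.prodMk (hflag.prodMk hcount)) (measurableSet_singleton _)
  have hmemA : ∀ ω, ω ∈ A ↔ R.s t ω = i ∧ (R.mem D t ω).flag i = b ∧ (R.mem D t ω).count i = k := by
    intro ω
    simp only [hAdef, Set.mem_preimage, Set.mem_singleton_iff, Prod.mk.injEq]
    constructor
    · rintro ⟨rfl, h2, h3⟩; exact ⟨rfl, h2, h3⟩
    · rintro ⟨rfl, h2, h3⟩; exact ⟨rfl, h2, h3⟩
  have hae := R.ae_abs_pert_le hp
  cases b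
  -- The counter never exceeds the elapsed time, so the weight inequalities are only needed below
  -- the horizon.
  · by_cases hk : t < k
    · have : A = ∅ := by
        refine Set.eq_empty_of_forall_notMem fun ω hω => ?_
        have h1 := p.memory_count_le D I (fun r => R.s r ω) (fun r => R.w r ω) (R.pert ω) t i
        have h2 := ((hmemA ω).1 hω).2.2
        unfold mem at h2
        omega
      simp [this]
    have hkT : k < T := by omega
    have he : Measurable fun ω => ‖(R.mem D t ω).est i - I.optInput i‖ₑ ^ 2 :=
      ((((MSPSA.measurable_est i).comp hm).sub_const _).enorm).pow_const 2
    have hea : ∀ a b : ℝ≥0∞, Measurable fun ω =>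
        a * ‖(R.mem D t ω).est i - I.optInput i‖ₑ ^ 2 + b := fun a b =>
      (he.const_mul a).add measurable_const
    have hpe : Measurable fun ω => p.pairErr D I i (k + 1) ((R.mem D t ω).est i)
        (R.δ i (k + 1) ω).ofLp :=
      MSPSA.measurable_pairErr h hD i (k + 1) ((MSPSA.measurable_est i).comp hm)
        ((WithLp.measurable_ofLp 2 _).comp (R.meas_δ i (k + 1)))
    have hres := R.setLIntegral_pairErr hp h hD t i k
    have hAset : {ω | R.s t ω = i ∧ (R.mem D t ω).flag i = false ∧ (R.mem D t ω).count i = k} = A :=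
      Set.ext fun ω => (hmemA ω).symm
    rw [hAset] at hres
    calc _ ≤ ∫⁻ ω in A, ((4 * ‖(R.mem D t ω).est i - I.optInput i‖ₑ ^ 2 +
            (2 * η i (k + 1) + ρ i (k + 1))) + α i (k + 1) *
            p.pairErr D I i (k + 1) ((R.mem D t ω).est i) (R.δ i (k + 1) ω).ofLp) ∂(R.μ) := by
          refine setLIntegral_mono_ae' hA ?_
          filter_upwards [hae] with ω hω hωA
          obtain ⟨h1, h2, h3⟩ := (hmemA ω).1 hωA
          have := MSPSA.enorm_input_add_potentialAfter_le_of_false (α := α) (ρ := ρ) h hD hη hω h2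
          rw [h3] at this
          rw [R.input_eq, h1]
          exact this
      _ = ∫⁻ ω in A, (4 * ‖(R.mem D t ω).est i - I.optInput i‖ₑ ^ 2 +
            (2 * η i (k + 1) + ρ i (k + 1))) ∂(R.μ) + α i (k + 1) * ∫⁻ ω in A, ∫⁻ v,
            p.pairErr D I i (k + 1) ((R.mem D t ω).est i) v ∂p.pertLaw ∂(R.μ) := by
          rw [lintegral_add_left (hea 4 _),
            lintegral_const_mul _ hpe, hres]
      _ ≤ ∫⁻ ω in A, (4 * ‖(R.mem D t ω).est i - I.optInput i‖ₑ ^ 2 +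
            (2 * η i (k + 1) + ρ i (k + 1))) ∂(R.μ) + α i (k + 1) * ∫⁻ ω in A,
            (q i (k + 1) * ‖(R.mem D t ω).est i - I.optInput i‖ₑ ^ 2 + β i (k + 1)) ∂(R.μ) := by
          gcongr with ω
          exact hpair i k _ (p.memory_est_mem I _ _ hDc hp.xInit_mem _ t i)
      _ = ∫⁻ ω in A, ((4 + q i (k + 1) * α i (k + 1)) *
            ‖(R.mem D t ω).est i - I.optInput i‖ₑ ^ 2 +
            (2 * η i (k + 1) + α i (k + 1) * β i (k + 1) + ρ i (k + 1))) ∂(R.μ) := by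
          rw [← lintegral_const_mul _ (hea _ _),
            ← lintegral_add_left (hea 4 _)]
          refine lintegral_congr fun ω => ?_
          ring
      _ ≤ ∫⁻ ω in A, p.potential D I α ρ η (R.mem D t ω) (R.pert ω) (R.s t ω) ∂(R.μ) := by
          refine setLIntegral_mono' hA fun ω hωA => ?_
          obtain ⟨h1, h2, h3⟩ := (hmemA ω).1 hωA
          rw [h1, MSPSA.potential, if_neg (by simp [h2]), h3]
          gcongr
          · exact hα i k hkT
          · exact hρ i k hkT
  · refine setLIntegral_mono_ae' hA ?_
    filter_upwards [hae] with ω hω hωA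
    obtain ⟨h1, h2, h3⟩ := (hmemA ω).1 hωA
    have := MSPSA.enorm_input_add_potentialAfter_le_of_true (α := α) (ρ := ρ) h hD hη hω h2
    rw [R.input_eq, h1]
    exact this

theorem measurable_potential_mem (R : Realization I p.ν) (h : I.Admissible Θ D σw)
    (hD : Measurable (euclProj D)) (t : ℕ) (i : Fin K) :
    Measurable fun ω => p.potential D I α ρ η (R.mem D t ω) (R.pert ω) i :=
  MSPSA.measurable_potential h hD (R.measurable_mem hD t) R.measurable_pert i

theorem measurable_cost (R : Realization I p.ν) (hD : Measurable (euclProj D)) (t : ℕ) :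
    Measurable fun ω => ‖R.input D t ω - I.optInput (R.s t ω)‖ₑ ^ 2 :=
  (((R.measurable_input hD t).sub
    ((measurable_of_countable I.optInput).comp (R.meas_s t))).enorm).pow_const 2

/-- The tower property: memory, perturbations and current state are known before the stage, and the
update adds only the next state and noise. Both sides evaluate the potential of the state visited at
time `t`. -/
theorem lintegral_potential_succ (R : Realization I p.ν)
    (h : I.Admissible Θ D σw) (hD : Measurable (euclProj D)) (t : ℕ) :
    ∫⁻ ω, p.potential D I α ρ η (R.mem D (t + 1) ω) (R.pert ω) (R.s t ω) ∂(R.μ) =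
      ∫⁻ ω, p.potentialAfter D I α ρ η (R.mem D t ω) (R.pert ω) (R.s t ω) ∂(R.μ) := by
  let S := MSPSA.Memory K n × (Fin K → ℕ → Vec n) × Fin K
  let F : S × (Fin K × Vec n) → ℝ≥0∞ := fun a => p.potential D I α ρ η
    (p.update D a.1.1 a.1.2.1 a.1.2.2
      (I.output a.2.1 (p.input a.1.1 a.1.2.1 a.1.2.2) a.2.2)) a.1.2.1 a.1.2.2
  have hF : Measurable F := by
    have h1 : Measurable fun a : S × (Fin K × Vec n) => a.1.1 := measurable_fst.fst
    have h2 : Measurable fun a : S × (Fin K × Vec n) => a.1.2.1 := measurable_fst.snd.fst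
    have h3 : Measurable fun a : S × (Fin K × Vec n) => a.1.2.2 := measurable_fst.snd.snd
    have hδ : ∀ i k, Measurable fun a : S × (Fin K × Vec n) => a.1.2.1 i k := fun i k =>
      (measurable_pi_apply k).comp ((measurable_pi_apply i).comp h2)
    have hin := p.measurable_input h1 hδ h3
    have hout := I.measurable_output_comp measurable_snd.fst hin measurable_snd.snd
    have hup := p.measurable_update hD h1 hδ h3 hout
    exact Measurable.apply_countable (F := fun i (a : S × (Fin K × Vec n)) =>
      p.potential D I α ρ η (p.update D a.1.1 a.1.2.1 a.1.2.2
      (I.output a.2.1 (p.input a.1.1 a.1.2.1 a.1.2.2) a.2.2)) a.1.2.1 i)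
      (fun i => MSPSA.measurable_potential h hD hup h2 i) h3
  have hZ : Measurable[R.hist t] fun ω => ((R.mem D t ω, R.pert ω, R.s t ω) : S) :=
    (R.measurable_hist_mem hD t).prodMk
      ((R.measurable_hist_pert t).prodMk (R.measurable_hist_s le_rfl))
  exact R.lintegral_next h hZ hF

theorem lintegral_cost_add_sum_potential_le (R : Realization I p.ν) (hp : p.Valid D ξ₁ ξ₂)
    (h : I.Admissible Θ D σw) (hDc : IsCompact D) (hD : Measurable (euclProj D)) {T t : ℕ}
    (ht : t < T)
    (hα : ∀ i, ∀ k < T, 4 + q i (k + 1) * α i (k + 1) ≤ α i k)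
    (hρ : ∀ i, ∀ k < T, 2 * η i (k + 1) + α i (k + 1) * β i (k + 1) + ρ i (k + 1) ≤ ρ i k)
    (hη : ∀ i k (v : Vec n), (∀ l, |v l| ≤ ξ₁) → 2 * ‖p.pertGain i k • v‖ₑ ^ 2 ≤ η i k)
    (hpair : ∀ i k, ∀ x ∈ D, ∫⁻ v, p.pairErr D I i (k + 1) x v ∂p.pertLaw ≤
      q i (k + 1) * ‖x - I.optInput i‖ₑ ^ 2 + β i (k + 1)) :
    ∫⁻ ω, ‖R.input D t ω - I.optInput (R.s t ω)‖ₑ ^ 2 ∂(R.μ) +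
        ∫⁻ ω, ∑ i, p.potential D I α ρ η (R.mem D (t + 1) ω) (R.pert ω) i ∂(R.μ) ≤
      ∫⁻ ω, ∑ i, p.potential D I α ρ η (R.mem D t ω) (R.pert ω) i ∂(R.μ) := by
  have hcost := R.measurable_cost hD t
  have hpot : ∀ t', Measurable fun ω =>
      p.potential D I α ρ η (R.mem D t' ω) (R.pert ω) (R.s t ω) := fun t' =>
    Measurable.apply_countable (F := fun i ω => p.potential D I α ρ η (R.mem D t' ω) (R.pert ω) i)
      (fun i => R.measurable_potential_mem h hD t' i) (R.meas_s t)
  let rest : R.Ω → ℝ≥0∞ := fun ω => ∑ j ∈ Finset.univ.erase (R.s t ω),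
    p.potential D I α ρ η (R.mem D t ω) (R.pert ω) j
  have e1 : ∀ ω, ∑ i, p.potential D I α ρ η (R.mem D (t + 1) ω) (R.pert ω) i =
      p.potential D I α ρ η (R.mem D (t + 1) ω) (R.pert ω) (R.s t ω) + rest ω := by
    intro ω
    rw [← Finset.add_sum_erase _ _ (Finset.mem_univ (R.s t ω))]
    congr 1
    refine Finset.sum_congr rfl fun j hj => ?_
    rw [R.mem_succ, p.potential_update_of_ne D I α ρ η _ _ (Finset.ne_of_mem_erase hj)]
  have e2 : ∀ ω, ∑ i, p.potential D I α ρ η (R.mem D t ω) (R.pert ω) i =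
      p.potential D I α ρ η (R.mem D t ω) (R.pert ω) (R.s t ω) + rest ω := fun ω =>
    (Finset.add_sum_erase _ _ (Finset.mem_univ (R.s t ω))).symm
  simp only [e1, e2]
  rw [lintegral_add_left (hpot (t + 1)), lintegral_add_left (hpot t), ← add_assoc,
    R.lintegral_potential_succ h hD, ← lintegral_add_left hcost]
  exact add_le_add (R.lintegral_cost_add_potentialAfter_le hp h hDc hD ht hα hρ hη hpair) le_rfl

/-- The input-MSE of MSPSA is bounded by the initial potential. -/
theorem inputMSE_le_potential (R : Realization I p.ν) (hp : p.Valid D ξ₁ ξ₂)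
    (h : I.Admissible Θ D σw) (hDc : IsCompact D) (hD : Measurable (euclProj D)) (T : ℕ)
    (hα : ∀ i, ∀ k < T, 4 + q i (k + 1) * α i (k + 1) ≤ α i k)
    (hρ : ∀ i, ∀ k < T, 2 * η i (k + 1) + α i (k + 1) * β i (k + 1) + ρ i (k + 1) ≤ ρ i k)
    (hη : ∀ i k (v : Vec n), (∀ l, |v l| ≤ ξ₁) → 2 * ‖p.pertGain i k • v‖ₑ ^ 2 ≤ η i k)
    (hpair : ∀ i k, ∀ x ∈ D, ∫⁻ v, p.pairErr D I i (k + 1) x v ∂p.pertLaw ≤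
      q i (k + 1) * ‖x - I.optInput i‖ₑ ^ 2 + β i (k + 1)) :
    R.inputMSE D T ≤ ∑ i, (α i 0 * ‖p.xInit i - I.optInput i‖ₑ ^ 2 + ρ i 0) := by
  have := R.prob
  -- The accumulated cost plus the current expected potential never exceeds the initial potential.
  have key : ∀ t ≤ T, ∑ r ∈ Finset.range t,
      ∫⁻ ω, ‖R.input D r ω - I.optInput (R.s r ω)‖ₑ ^ 2 ∂(R.μ) +
      ∫⁻ ω, ∑ i, p.potential D I α ρ η (R.mem D t ω) (R.pert ω) i ∂(R.μ) ≤
      ∫⁻ ω, ∑ i, p.potential D I α ρ η (R.mem D 0 ω) (R.pert ω) i ∂(R.μ) := by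
    intro t ht
    induction t with
    | zero => simp
    | succ t ih =>
      refine le_trans ?_ (ih (by omega))
      rw [Finset.sum_range_succ, add_assoc]
      gcongr
      exact R.lintegral_cost_add_sum_potential_le hp h hDc hD (by omega) hα hρ hη hpair
  have e0 : ∫⁻ ω, ∑ i, p.potential D I α ρ η (R.mem D 0 ω) (R.pert ω) i ∂(R.μ) =
      ∑ i, (α i 0 * ‖p.xInit i - I.optInput i‖ₑ ^ 2 + ρ i 0) := by
    have : ∀ ω, ∑ i, p.potential D I α ρ η (R.mem D 0 ω) (R.pert ω) i =
        ∑ i, (α i 0 * ‖p.xInit i - I.optInput i‖ₑ ^ 2 + ρ i 0) := fun ω => rfl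
    simp only [this]
    rw [lintegral_const, measure_univ, mul_one]
  rw [inputMSE, lintegral_finsetSum _ fun t _ => R.measurable_cost hD t, ← e0]
  exact le_self_add.trans (key T le_rfl)

end Realization

/-! ### The error recursion and sums of inverse square roots. -/

/-- Weights that turn a recursive bound into a bound on the cumulative error. -/
theorem exists_weights (T : ℕ) (q β η u : ℕ → ℝ≥0∞)
    (hu : ∀ k < T, q (k + 1) * u k + β (k + 1) ≤ u (k + 1)) :
    ∃ α ρ : ℕ → ℝ≥0∞, (∀ k < T, 4 + q (k + 1) * α (k + 1) ≤ α k) ∧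
      (∀ k < T, 2 * η (k + 1) + α (k + 1) * β (k + 1) + ρ (k + 1) ≤ ρ k) ∧
      α 0 * u 0 + ρ 0 ≤ ∑ k ∈ Finset.range T, (4 * u k + 2 * η (k + 1)) := by
  induction T generalizing q β η u with
  | zero => exact ⟨0, 0, by simp, by simp, by simp⟩
  | succ T ih =>
    obtain ⟨α, ρ, h1, h2, h3⟩ := ih (fun k => q (k + 1)) (fun k => β (k + 1))
      (fun k => η (k + 1)) (fun k => u (k + 1)) fun k hk => hu (k + 1) (by omega)
    -- Weights vanish at the horizon and satisfy the constraints with equality going backwards; the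
    -- induction supplies those of the shifted sequences, and index `0` is prepended.
    refine ⟨fun k => Nat.casesOn k (4 + q 1 * α 0) α,
      fun k => Nat.casesOn k (2 * η 1 + α 0 * β 1 + ρ 0) ρ, ?_, ?_, ?_⟩
    · rintro (_ | k) hk
      · exact le_rfl
      · exact h1 k (by omega)
    · rintro (_ | k) hk
      · exact le_rfl
      · exact h2 k (by omega)
    · rw [Finset.sum_range_succ']
      calc (4 + q 1 * α 0) * u 0 + (2 * η 1 + α 0 * β 1 + ρ 0)
          = α 0 * (q 1 * u 0 + β 1) + ρ 0 + (4 * u 0 + 2 * η 1) := by ring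
        _ ≤ α 0 * u 1 + ρ 0 + (4 * u 0 + 2 * η 1) := by
          gcongr
          exact hu 0 (by omega)
        _ ≤ _ := by gcongr

theorem sum_one_div_sqrt_le (T : ℕ) :
    ∑ k ∈ Finset.range T, 1 / √((k : ℝ) + 1) ≤ 2 * √T := by
  induction T with
  | zero => simp
  | succ T ih =>
    rw [Finset.sum_range_succ]
    have h1 : (0 : ℝ) < √((T : ℝ) + 1) := Real.sqrt_pos.2 (by positivity)
    have h2 := Real.sq_sqrt (show (0 : ℝ) ≤ (T : ℝ) + 1 by positivity)
    have h3 := Real.sq_sqrt (Nat.cast_nonneg (α := ℝ) T)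
    have h4 : 1 / √((T : ℝ) + 1) ≤ 2 * √((T : ℝ) + 1) - 2 * √(T : ℝ) := by
      rw [div_le_iff₀ h1]
      nlinarith [sq_nonneg (√((T : ℝ) + 1) - √(T : ℝ))]
    push_cast
    linarith

/-- The contraction `1/m` exceeds the relative decay of `1/√m`, about `1/(2m)`. The surplus of order
`(B/2) m^(-3/2)` absorbs the noise term `b m^(-3/2)`, hence the condition `2 b ≤ B`. -/
theorem one_sub_mul_div_sqrt_add_le {m B b : ℝ} (hm : 1 ≤ m) (hb : 2 * b ≤ B) (hB : 0 ≤ B) :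
    (1 - 1 / m) * (B / √m) + b * √m / m ^ 2 ≤ B / √(m + 1) := by
  have hr : 0 < √m := Real.sqrt_pos.2 (by linarith)
  have hr2 := Real.sq_sqrt (show 0 ≤ m by linarith)
  set r := √m
  have h1 : √(m + 1) ≤ r + 1 / (2 * r) := by
    rw [Real.sqrt_le_left (by positivity)]
    have : (r + 1 / (2 * r)) ^ 2 = r ^ 2 + 1 + (1 / (2 * r)) ^ 2 := by field_simp; ring
    rw [this, hr2]
    have := sq_nonneg (1 / (2 * r))
    linarith
  have h0 : 0 < √(m + 1) := Real.sqrt_pos.2 (by linarith)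
  have h2 : B / (r + 1 / (2 * r)) ≤ B / √(m + 1) := div_le_div_of_nonneg_left hB h0 h1
  refine le_trans ?_ h2
  rw [← hr2]
  have e1 : (1 - 1 / r ^ 2) * (B / r) + b * r / (r ^ 2) ^ 2 = (B * r ^ 2 - B + b) / r ^ 3 := by
    field_simp
  have e2 : B / (r + 1 / (2 * r)) = 2 * r * B / (2 * r ^ 2 + 1) := by
    field_simp
  rw [e1, e2, div_le_div_iff₀ (by positivity) (by positivity)]
  nlinarith [mul_nonneg hB (sq_nonneg r), mul_le_mul_of_nonneg_right hb (by positivity :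
    0 ≤ 2 * r ^ 2 + 1)]

theorem exists_norm_params_le {K n : ℕ} {Θ : Set (Params K n)} (hΘ : IsCompact Θ) :
    ∃ M : ℝ, 0 ≤ M ∧ ∀ θ ∈ Θ, ∀ k, (∀ x : Vec n, ‖(θ k).1.toEuclideanLin x‖ ≤ M * ‖x‖) ∧
      ‖(θ k).2‖ ≤ M := by
  let f : Params K n → Fin K → (Vec n →L[ℝ] Vec n) × Vec n := fun θ k =>
    (Matrix.toEuclideanCLM (n := Fin n) (𝕜 := ℝ) (θ k).1, (θ k).2)
  have hc : Continuous fun A : Matrix (Fin n) (Fin n) ℝ =>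
      Matrix.toEuclideanCLM (n := Fin n) (𝕜 := ℝ) A :=
    (Matrix.toEuclideanCLM (n := Fin n) (𝕜 := ℝ)).toAlgEquiv.toLinearMap.continuous_of_finiteDimensional
  have hf : Continuous f := continuous_pi fun k =>
    (hc.comp (continuous_apply k).fst).prodMk (continuous_apply k).snd
  obtain ⟨C, hC⟩ := hΘ.exists_bound_of_continuousOn hf.continuousOn
  refine ⟨max C 0, le_max_right _ _, fun θ hθ k => ?_⟩
  have h1 : ‖f θ k‖ ≤ max C 0 := (norm_le_pi_norm _ k).trans ((hC θ hθ).trans (le_max_left _ _))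
  refine ⟨fun x => ?_, (norm_snd_le (f θ k)).trans h1⟩
  exact ((f θ k).1.le_opNorm x).trans (by gcongr; exact (norm_fst_le (f θ k)).trans h1)

/-! ### Estimates for the gains and the one-step constants. -/

namespace MSPSA

variable {K n : ℕ} {p : MSPSA K n} {I : Model K n} {Θ : Set (Params K n)} {D : Set (Vec n)}
  {σw ξ₁ ξ₂ : ℝ}

theorem Valid.pertGain_nonneg (hp : p.Valid D ξ₁ ξ₂) (i : Fin K) (k : ℕ) :
    0 ≤ p.pertGain i k :=
  div_nonneg (hp.γ'_pos i).le (Real.rpow_nonneg (by positivity) _)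

theorem Valid.pertGain_le (hp : p.Valid D ξ₁ ξ₂) (i : Fin K) (k : ℕ) :
    p.pertGain i k ≤ p.γ' i := by
  unfold pertGain
  rcases Nat.eq_zero_or_pos (p.N' i + k) with h | h
  · have : ((p.N' i : ℝ) + k) = 0 := by exact_mod_cast h
    rw [this, Real.zero_rpow (by norm_num), div_zero]
    exact (hp.γ'_pos i).le
  · refine div_le_self (hp.γ'_pos i).le (Real.one_le_rpow ?_ (by norm_num))
    exact_mod_cast h

theorem rpow_quarter_sq {x : ℝ} (hx : 0 ≤ x) : (x ^ (1 / 4 : ℝ)) ^ 2 = √x := by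
  rw [← Real.rpow_natCast, ← Real.rpow_mul hx, Real.sqrt_eq_rpow]
  norm_num

theorem pertGain_sq (i : Fin K) (k : ℕ) :
    p.pertGain i k ^ 2 = p.γ' i ^ 2 / √((p.N' i : ℝ) + k) := by
  rw [pertGain, div_pow, rpow_quarter_sq (by positivity)]

theorem pertGain_succ_sq_le (i : Fin K) (k : ℕ) :
    p.pertGain i (k + 1) ^ 2 ≤ p.γ' i ^ 2 * (1 / √((k : ℝ) + 1)) := by
  rw [pertGain_sq, mul_one_div]
  push_cast
  exact div_le_div_of_nonneg_left (sq_nonneg _) (Real.sqrt_pos.2 (by positivity))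
    (Real.sqrt_le_sqrt (by linarith [Nat.cast_nonneg (α := ℝ) (p.N' i)]))

/-- The two gains have different offsets. Since `N' + k + 1 ≤ (N' + 1)(N + k + 1)`, everything can
be expressed in the single variable `m = N + k + 1` of the recursion. -/
theorem Valid.gain_ratio_sq_le (hp : p.Valid D ξ₁ ξ₂) (i : Fin K) (k : ℕ) :
    (p.stepGain i (k + 1) / p.pertGain i (k + 1)) ^ 2 ≤
      p.γ i ^ 2 / p.γ' i ^ 2 * √((p.N' i : ℝ) + 1) * √((p.N i : ℝ) + k + 1) /
        ((p.N i : ℝ) + k + 1) ^ 2 := by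
  have hγ' := hp.γ'_pos i
  have hN : (0 : ℝ) ≤ p.N i := Nat.cast_nonneg _
  have hN' : (0 : ℝ) ≤ p.N' i := Nat.cast_nonneg _
  have hk : (0 : ℝ) ≤ k := Nat.cast_nonneg _
  have hm : (0 : ℝ) < (p.N i : ℝ) + k + 1 := by positivity
  have hs : 0 < √((p.N' i : ℝ) + (k + 1)) := Real.sqrt_pos.2 (by positivity)
  rw [div_pow, pertGain_sq, stepGain, div_pow]
  push_cast
  have e : p.γ i ^ 2 / ((p.N i : ℝ) + (k + 1)) ^ 2 / (p.γ' i ^ 2 / √((p.N' i : ℝ) + (k + 1))) =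
      p.γ i ^ 2 / p.γ' i ^ 2 * √((p.N' i : ℝ) + (k + 1)) / ((p.N i : ℝ) + k + 1) ^ 2 := by
    rw [← add_assoc]
    field_simp
  rw [e, mul_assoc (p.γ i ^ 2 / p.γ' i ^ 2), ← Real.sqrt_mul (by positivity)]
  gcongr
  nlinarith [mul_nonneg hN' hN, mul_nonneg hN' hk]

theorem Valid.norm_pertGain_smul_le (hp : p.Valid D ξ₁ ξ₂) (i : Fin K) (k : ℕ) {v : Vec n}
    (hv : ∀ l, |v l| ≤ ξ₁) :
    ‖p.pertGain i k • v‖ ≤ (∑ j, p.γ' j) * √(n * ξ₁ ^ 2) := by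
  rw [norm_smul, Real.norm_of_nonneg (hp.pertGain_nonneg i k)]
  have h1 : p.pertGain i k ≤ ∑ j, p.γ' j := (hp.pertGain_le i k).trans
    (Finset.single_le_sum (fun j _ => (hp.γ'_pos j).le) (Finset.mem_univ i))
  have h2 : ‖v‖ ≤ √(n * ξ₁ ^ 2) := Real.le_sqrt_of_sq_le (norm_le_of_abs_le hv)
  exact mul_le_mul h1 h2 (norm_nonneg _) (Finset.sum_nonneg fun j _ => (hp.γ'_pos j).le)

theorem two_mul_enorm_smul_sq_le (c : ℝ) {v : Vec n} {ξ : ℝ} (hv : ∀ l, |v l| ≤ ξ) :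
    2 * ‖c • v‖ₑ ^ 2 ≤ ENNReal.ofReal (2 * (c ^ 2 * (n * ξ ^ 2))) := by
  rw [← ofReal_norm, ← ENNReal.ofReal_pow (norm_nonneg _), ENNReal.ofReal_mul zero_le_two,
    ENNReal.ofReal_ofNat, norm_smul, mul_pow, Real.norm_eq_abs, sq_abs]
  gcongr
  exact norm_le_of_abs_le hv

theorem Valid.lintegral_pairErr_le (hp : p.Valid D ξ₁ ξ₂) (hξ₂ : 0 ≤ ξ₂) (hD : IsCompact D)
    (hconv : Convex ℝ D) (h : I.Admissible Θ D σw) (hstep : p.StepCondition I) {M : ℝ}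
    (hM : 0 ≤ M) (hA : ∀ j x, ‖(I.A j).toEuclideanLin x‖ ≤ M * ‖x‖) (hb : ∀ j, ‖I.b j‖ ≤ M)
    {r R : ℝ} (hr : ∀ x ∈ D, ‖x‖ ≤ r) (hR : r + (∑ j, p.γ' j) * √(n * ξ₁ ^ 2) ≤ R)
    (i : Fin K) (k : ℕ) {x : Vec n} (hx : x ∈ D) :
    ∫⁻ v, p.pairErr D I i (k + 1) x v ∂p.pertLaw ≤
      ENNReal.ofReal (1 - 1 / ((p.N i : ℝ) + k + 1)) * ‖x - I.optInput i‖ₑ ^ 2 +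
      ENNReal.ofReal (4 * (2 * R ^ 2 * ((M * R + M) ^ 2 + n * σw ^ 2)) *
        (p.stepGain i (k + 1) / p.pertGain i (k + 1)) ^ 2 * (n * ξ₂)) := by
  have hS : ∀ v : Vec n, (∀ l, |v l| ≤ ξ₁) →
      ∫ z, I.obsCost (x + p.pertGain i (k + 1) • v) z ^ 2 ∂(I.next i) ≤
        2 * R ^ 2 * ((M * R + M) ^ 2 + n * σw ^ 2) ∧
      ∫ z, I.obsCost (x - p.pertGain i (k + 1) • v) z ^ 2 ∂(I.next i) ≤
        2 * R ^ 2 * ((M * R + M) ^ 2 + n * σw ^ 2) := by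
    intro v hv
    have h1 := hp.norm_pertGain_smul_le i (k + 1) hv
    have h2 := hr x hx
    exact ⟨h.integral_sq_obsCost_le hM hA hb ((norm_add_le _ _).trans (by linarith)) i,
      h.integral_sq_obsCost_le hM hA hb ((norm_sub_le _ _).trans (by linarith)) i⟩
  refine (hp.lintegral_newEst_le hξ₂ hD hconv h hstep i (Nat.le_add_left 1 k) x hS).trans ?_
  refine ENNReal.ofReal_add_le.trans ?_
  gcongr
  have h1 : 0 ≤ 1 - 1 / ((p.N i : ℝ) + k + 1) := by
    rw [sub_nonneg, div_le_one (by positivity)]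
    linarith [Nat.cast_nonneg (α := ℝ) (p.N i), Nat.cast_nonneg (α := ℝ) k]
  push_cast
  rw [← add_assoc, ENNReal.ofReal_mul h1, ENNReal.ofReal_pow (norm_nonneg _), ofReal_norm]

end MSPSA

/-! ### From squared input error to regret. -/

namespace Model

variable {K n : ℕ} {I : Model K n} {Θ : Set (Params K n)} {D : Set (Vec n)} {σw : ℝ}

theorem Admissible.stageCost_optInput_le (h : I.Admissible Θ D σw) (i : Fin K) (x : Vec n) :
    0 ≤ I.stageCost i x - I.stageCost i (I.optInput i) := by
  rw [h.stageCost_sub_optInput, inner_toEuclideanLin_eq]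
  have := (h.posDef_hess i).posSemidef.dotProduct_mulVec_nonneg (x - I.optInput i).ofLp
  simp only [star_trivial] at this
  positivity

/-- The excess cost equals `-∑ p ⟪e, A e⟫`, an average of forms bounded by `M ‖e‖²`. -/
theorem Admissible.stageCost_sub_le (h : I.Admissible Θ D σw) {M : ℝ}
    (hA : ∀ j x, ‖(I.A j).toEuclideanLin x‖ ≤ M * ‖x‖) (i : Fin K) (x : Vec n) :
    I.stageCost i x - I.stageCost i (I.optInput i) ≤ M * ‖x - I.optInput i‖ ^ 2 := by
  rw [h.stageCost_sub_optInput, inner_hess]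
  set e := x - I.optInput i
  have h1 : ∀ j, -(M * ‖e‖ ^ 2) ≤ inner ℝ e ((I.A j).toEuclideanLin e) := by
    intro j
    have h1 := (abs_le.1 (abs_real_inner_le_norm e ((I.A j).toEuclideanLin e))).1
    have h2 := mul_le_mul_of_nonneg_left (hA j e) (norm_nonneg e)
    nlinarith
  have h2 : ∑ j, I.P i j * (2 * -(M * ‖e‖ ^ 2)) ≤ ∑ j, I.P i j *
      (inner ℝ e ((I.A j).toEuclideanLin e) + inner ℝ e ((I.A j).toEuclideanLin e)) :=
    Finset.sum_le_sum fun j _ => mul_le_mul_of_nonneg_left (by linarith [h1 j]) (h.P_nonneg i j)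
  rw [← Finset.sum_mul, h.P_sum] at h2
  linarith

theorem Admissible.measurable_stageCost (h : I.Admissible Θ D σw) (i : Fin K) :
    Measurable (I.stageCost i) := by
  have e : I.stageCost i = fun x =>
      1 / 2 * inner ℝ x ((I.hess i).toEuclideanLin x) - inner ℝ x (I.meanB i) :=
    funext (h.stageCost_eq i)
  have hL : Measurable fun x : Vec n => (I.hess i).toEuclideanLin x :=
    (LinearMap.continuous_of_finiteDimensional _).measurable
  rw [e]
  exact ((measurable_id.inner hL).const_mul _).sub (measurable_id.inner measurable_const)

end Model

namespace Realization

variable {K n : ℕ} {p : MSPSA K n} {I : Model K n} {Θ : Set (Params K n)} {D : Set (Vec n)}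
  {σw ξ₁ ξ₂ : ℝ}

theorem measurable_euclProj (R : Realization I p.ν) (hp : p.Valid D ξ₁ ξ₂) (hD : IsCompact D)
    (hconv : Convex ℝ D) : Measurable (euclProj D) := by
  have := R.prob
  obtain ⟨ω⟩ := nonempty_of_isProbabilityMeasure R.μ
  exact (continuous_euclProj hD hconv ⟨_, hp.xInit_mem (R.s 0 ω)⟩).measurable

theorem costGap_eq (R : Realization I p.ν) (D : Set (Vec n)) (T : ℕ) (ω : R.Ω) :
    R.costGap D T ω = ∑ t ∈ Finset.range T, (I.stageCost (R.s t ω) (R.input D t ω) -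
      I.stageCost (R.s t ω) (I.optInput (R.s t ω))) := by
  rw [costGap, Finset.sum_sub_distrib]

theorem costGap_nonneg (R : Realization I p.ν) (h : I.Admissible Θ D σw) (T : ℕ) (ω : R.Ω) :
    0 ≤ R.costGap D T ω := by
  rw [costGap_eq]
  exact Finset.sum_nonneg fun t _ => h.stageCost_optInput_le _ _

theorem measurable_costGap (R : Realization I p.ν) (h : I.Admissible Θ D σw)
    (hD : Measurable (euclProj D)) (T : ℕ) : Measurable (R.costGap D T) := by
  have h1 : ∀ t, Measurable fun ω => I.stageCost (R.s t ω) (R.input D t ω) := fun t =>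
    Measurable.apply_countable (F := fun i ω => I.stageCost i (R.input D t ω))
      (fun i => (h.measurable_stageCost i).comp (R.measurable_input hD t)) (R.meas_s t)
  have h2 : ∀ t, Measurable fun ω => I.stageCost (R.s t ω) (I.optInput (R.s t ω)) := fun t =>
    (measurable_of_countable fun i => I.stageCost i (I.optInput i)).comp (R.meas_s t)
  unfold costGap
  exact (Finset.measurable_sum _ fun t _ => h1 t).sub (Finset.measurable_sum _ fun t _ => h2 t)

theorem norm_input_le (R : Realization I p.ν) (hp : p.Valid D ξ₁ ξ₂) (hD : IsCompact D)
    {r : ℝ} (hr : ∀ x ∈ D, ‖x‖ ≤ r) (t : ℕ) {ω : R.Ω} (hω : ∀ i k l, |R.pert ω i k l| ≤ ξ₁) :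
    ‖R.input D t ω‖ ≤ r + (∑ j, p.γ' j) * √(n * ξ₁ ^ 2) := by
  have hest : ‖(R.mem D t ω).est (R.s t ω)‖ ≤ r :=
    hr _ (p.memory_est_mem I _ _ hD hp.xInit_mem _ t _)
  rw [R.input_eq]
  cases hf : (R.mem D t ω).flag (R.s t ω)
  · rw [p.input_of_flag_false hf]
    exact (norm_add_le _ _).trans (add_le_add hest (hp.norm_pertGain_smul_le _ _ (hω _ _)))
  · rw [p.input_of_flag_true hf]
    exact (norm_sub_le _ _).trans (add_le_add hest (hp.norm_pertGain_smul_le _ _ (hω _ _)))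

/-- Estimates lie in `D` and perturbations are almost surely bounded, so the gap itself is almost
surely bounded; the noise enters only through the inputs. -/
theorem integrable_costGap (R : Realization I p.ν) (hp : p.Valid D ξ₁ ξ₂) (hD : IsCompact D)
    (hconv : Convex ℝ D) (h : I.Admissible Θ D σw) {M : ℝ} (hM : 0 ≤ M)
    (hA : ∀ j x, ‖(I.A j).toEuclideanLin x‖ ≤ M * ‖x‖) (T : ℕ) :
    Integrable (R.costGap D T) R.μ := by
  have := R.prob
  obtain ⟨r, hr⟩ := hD.isBounded.exists_norm_le
  refine Integrable.of_bound (R.measurable_costGap h (R.measurable_euclProj hp hD hconv)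
    T).aestronglyMeasurable
    (∑ _t ∈ Finset.range T, M * (r + (∑ j, p.γ' j) * √(n * ξ₁ ^ 2) + r) ^ 2) ?_
  filter_upwards [R.ae_abs_pert_le hp] with ω hω
  rw [Real.norm_of_nonneg (R.costGap_nonneg h T ω), costGap_eq]
  refine Finset.sum_le_sum fun t _ => (h.stageCost_sub_le hA _ _).trans ?_
  gcongr
  exact (norm_sub_le _ _).trans
    (add_le_add (R.norm_input_le hp hD hr t hω) (hr _ (h.optInput_mem _)))

theorem regret_le (R : Realization I p.ν) (hp : p.Valid D ξ₁ ξ₂) (hD : IsCompact D)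
    (hconv : Convex ℝ D) (h : I.Admissible Θ D σw) {M : ℝ} (hM : 0 ≤ M)
    (hA : ∀ j x, ‖(I.A j).toEuclideanLin x‖ ≤ M * ‖x‖) {T : ℕ} {B : ℝ} (hB : 0 ≤ B)
    (hmse : R.inputMSE D T ≤ ENNReal.ofReal B) : R.regret D T ≤ M * B := by
  have hproj := R.measurable_euclProj hp hD hconv
  have h1 : ENNReal.ofReal (R.regret D T) ≤ ENNReal.ofReal (M * B) := by
    rw [regret, ofReal_integral_eq_lintegral_ofReal (R.integrable_costGap hp hD hconv h hM hA T)
      (ae_of_all _ (R.costGap_nonneg h T)), ENNReal.ofReal_mul hM]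
    refine le_trans ?_ (mul_le_mul_right hmse _)
    rw [inputMSE, ← lintegral_const_mul _
      (Finset.measurable_sum _ fun t _ => R.measurable_cost hproj t)]
    refine lintegral_mono fun ω => ?_
    rw [costGap_eq, ENNReal.ofReal_sum_of_nonneg fun t _ => h.stageCost_optInput_le _ _,
      Finset.mul_sum]
    refine Finset.sum_le_sum fun t _ => ?_
    refine (ENNReal.ofReal_le_ofReal (h.stageCost_sub_le hA _ _)).trans (le_of_eq ?_)
    rw [ENNReal.ofReal_mul hM, ENNReal.ofReal_pow (norm_nonneg _), ofReal_norm]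
  exact (ENNReal.ofReal_le_ofReal_iff (mul_nonneg hM hB)).1 h1

end Realization

/-! ### Choice of constants and conclusion. -/

namespace MSPSA

variable {K n : ℕ} {p : MSPSA K n} {Θ : Set (Params K n)} {D : Set (Vec n)} {σw ξ₁ ξ₂ : ℝ}

/-- The cumulative input-MSE of MSPSA is of order `√T`, uniformly over the models. -/
theorem Valid.exists_inputMSE_le (hp : p.Valid D ξ₁ ξ₂) (hξ₂ : 0 ≤ ξ₂) (hD : IsCompact D)
    (hconv : Convex ℝ D) (σw : ℝ) {M : ℝ} (hM : 0 ≤ M)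
    (hΘ : ∀ θ ∈ Θ, ∀ k, (∀ x : Vec n, ‖(θ k).1.toEuclideanLin x‖ ≤ M * ‖x‖) ∧ ‖(θ k).2‖ ≤ M) :
    ∃ C > (0 : ℝ), ∀ I : Model K n, I.Admissible Θ D σw → p.StepCondition I →
      ∀ (R : Realization I p.ν) (T : ℕ), R.inputMSE D T ≤ ENNReal.ofReal (C * √T) := by
  obtain ⟨r, hr⟩ := hD.isBounded.exists_norm_le
  set R₀ := r + (∑ j, p.γ' j) * √(n * ξ₁ ^ 2) with hR₀
  set S := 2 * R₀ ^ 2 * ((M * R₀ + M) ^ 2 + n * σw ^ 2) with hS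
  have hS0 : 0 ≤ S := by positivity
  let b : Fin K → ℝ := fun i => 4 * S * (p.γ i ^ 2 / p.γ' i ^ 2 * √((p.N' i : ℝ) + 1)) * (n * ξ₂)
  have hb0 : ∀ i, 0 ≤ b i := fun i => by positivity
  -- The summand `2 b i` absorbs the noise in the recursion. The other makes `u i 0 = B i / √(N +
  -- 1)` at least `(2 r)²`, a bound on the initial squared error.
  let B : Fin K → ℝ := fun i => 2 * b i + (r + r) ^ 2 * √((p.N i : ℝ) + 1)
  have hB0 : ∀ i, 0 ≤ B i := fun i => by have := hb0 i; positivity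
  let C : Fin K → ℝ := fun i => 4 * B i + 4 * (p.γ' i ^ 2 * (n * ξ₁ ^ 2))
  have hC0 : ∀ i, 0 ≤ C i := fun i => by have := hB0 i; positivity
  let q : Fin K → ℕ → ℝ≥0∞ := fun i k => ENNReal.ofReal (1 - 1 / ((p.N i : ℝ) + k))
  let β : Fin K → ℕ → ℝ≥0∞ := fun i k => ENNReal.ofReal
    (4 * S * (p.stepGain i k / p.pertGain i k) ^ 2 * (n * ξ₂))
  let η : Fin K → ℕ → ℝ≥0∞ := fun i k =>
    ENNReal.ofReal (2 * (p.pertGain i k ^ 2 * (n * ξ₁ ^ 2)))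
  let u : Fin K → ℕ → ℝ≥0∞ := fun i k => ENNReal.ofReal (B i / √((p.N i : ℝ) + k + 1))
  -- The factor `2` comes from `∑ 1/√(k+1) ≤ 2 √T`; adding `1` keeps the constant positive even when
  -- all `C i` vanish or there are no states.
  refine ⟨2 * ∑ i, C i + 1, by have := Finset.sum_nonneg fun i (_ : i ∈ Finset.univ) => hC0 i
                               linarith, ?_⟩
  intro I h hstep R T
  have hu : ∀ i k, q i (k + 1) * u i k + β i (k + 1) ≤ u i (k + 1) := by
    intro i k
    have hN : (0 : ℝ) ≤ p.N i := Nat.cast_nonneg _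
    have hk : (0 : ℝ) ≤ k := Nat.cast_nonneg _
    have hm : 1 ≤ (p.N i : ℝ) + k + 1 := by linarith
    have hq0 : 0 ≤ 1 - 1 / ((p.N i : ℝ) + (k + 1)) := by
      rw [sub_nonneg, div_le_one (by positivity)]
      linarith
    have hβ : 4 * S * (p.stepGain i (k + 1) / p.pertGain i (k + 1)) ^ 2 * (n * ξ₂) ≤
        b i * √((p.N i : ℝ) + k + 1) / ((p.N i : ℝ) + k + 1) ^ 2 := by
      have h1 := hp.gain_ratio_sq_le i k
      have h2 := mul_le_mul_of_nonneg_left h1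
        (show 0 ≤ 4 * S * (n * ξ₂) by positivity)
      calc _ = 4 * S * (n * ξ₂) * (p.stepGain i (k + 1) / p.pertGain i (k + 1)) ^ 2 := by ring
        _ ≤ _ := h2
        _ = _ := by simp only [b]; ring
    have key := one_sub_mul_div_sqrt_add_le hm (show 2 * b i ≤ B i by
      simp only [B]; have : 0 ≤ (r + r) ^ 2 * √((p.N i : ℝ) + 1) := by positivity
      linarith) (hB0 i)
    simp only [q, u, β]
    push_cast
    rw [← ENNReal.ofReal_mul hq0, ← ENNReal.ofReal_add (mul_nonneg hq0 (by
      have := hB0 i; positivity)) (by positivity)]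
    refine ENNReal.ofReal_le_ofReal ?_
    rw [← add_assoc]
    linarith
  have hu0 : ∀ i, ‖p.xInit i - I.optInput i‖ₑ ^ 2 ≤ u i 0 := by
    intro i
    have h1 : ‖p.xInit i - I.optInput i‖ ≤ r + r :=
      (norm_sub_le _ _).trans (add_le_add (hr _ (hp.xInit_mem i)) (hr _ (h.optInput_mem i)))
    have h2 := pow_le_pow_left₀ (norm_nonneg _) h1 2
    rw [← ofReal_norm, ← ENNReal.ofReal_pow (norm_nonneg _)]
    refine ENNReal.ofReal_le_ofReal (h2.trans ?_)
    rw [le_div_iff₀ (Real.sqrt_pos.2 (by positivity))]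
    simp only [B, Nat.cast_zero, add_zero]
    linarith [hb0 i]
  have hη : ∀ i k (v : Vec n), (∀ l, |v l| ≤ ξ₁) → 2 * ‖p.pertGain i k • v‖ₑ ^ 2 ≤ η i k :=
    fun i k v hv => two_mul_enorm_smul_sq_le _ hv
  have hpair : ∀ i k, ∀ x ∈ D, ∫⁻ v, p.pairErr D I i (k + 1) x v ∂p.pertLaw ≤
      q i (k + 1) * ‖x - I.optInput i‖ₑ ^ 2 + β i (k + 1) := by
    intro i k x hx
    have := hp.lintegral_pairErr_le hξ₂ hD hconv h hstep hM (fun j => (hΘ _ h.θ_mem j).1)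
      (fun j => (hΘ _ h.θ_mem j).2) hr hR₀.ge i k hx
    simp only [q, β]
    push_cast
    rw [← add_assoc]
    exact this
  choose α ρ hα hρ hsum using fun i => exists_weights T (q i) (β i) (η i) (u i) fun k _ => hu i k
  have hterm : ∀ i k, 4 * u i k + 2 * η i (k + 1) ≤
      ENNReal.ofReal (C i * (1 / √((k : ℝ) + 1))) := by
    intro i k
    have hN : (0 : ℝ) ≤ p.N i := Nat.cast_nonneg _
    have h1 : B i / √((p.N i : ℝ) + k + 1) ≤ B i * (1 / √((k : ℝ) + 1)) := by
      rw [mul_one_div]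
      exact div_le_div_of_nonneg_left (hB0 i) (Real.sqrt_pos.2 (by positivity))
        (Real.sqrt_le_sqrt (by linarith))
    have h2 := mul_le_mul_of_nonneg_right (p.pertGain_succ_sq_le i k)
      (show 0 ≤ n * ξ₁ ^ 2 by positivity)
    have h3 : 0 ≤ B i / √((p.N i : ℝ) + k + 1) := by have := hB0 i; positivity
    have e4 : (4 : ℝ≥0∞) = ENNReal.ofReal 4 := by simp
    have e2 : (2 : ℝ≥0∞) = ENNReal.ofReal 2 := by simp
    simp only [u, η]
    rw [e4, e2, ← ENNReal.ofReal_mul (by norm_num), ← ENNReal.ofReal_mul (by norm_num),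
      ← ENNReal.ofReal_add (by positivity) (by positivity)]
    refine ENNReal.ofReal_le_ofReal ?_
    simp only [C]
    linarith
  calc R.inputMSE D T
      ≤ ∑ i, (α i 0 * ‖p.xInit i - I.optInput i‖ₑ ^ 2 + ρ i 0) :=
        R.inputMSE_le_potential hp h hD (R.measurable_euclProj hp hD hconv) T hα hρ hη hpair
    _ ≤ ∑ i, ∑ k ∈ Finset.range T, ENNReal.ofReal (C i * (1 / √((k : ℝ) + 1))) := by
        refine Finset.sum_le_sum fun i _ => ?_
        refine le_trans ?_ ((hsum i).trans (Finset.sum_le_sum fun k _ => hterm i k))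
        gcongr
        exact hu0 i
    _ = ENNReal.ofReal (∑ i, C i * ∑ k ∈ Finset.range T, 1 / √((k : ℝ) + 1)) := by
        rw [ENNReal.ofReal_sum_of_nonneg fun i _ => mul_nonneg (hC0 i)
          (Finset.sum_nonneg fun k _ => by positivity)]
        refine Finset.sum_congr rfl fun i _ => ?_
        rw [Finset.mul_sum, ENNReal.ofReal_sum_of_nonneg fun k _ => mul_nonneg (hC0 i)
          (by positivity)]
    _ ≤ ENNReal.ofReal ((2 * ∑ i, C i + 1) * √T) := by
        refine ENNReal.ofReal_le_ofReal ?_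
        rw [← Finset.sum_mul]
        have h1 := mul_le_mul_of_nonneg_left (sum_one_div_sqrt_le T)
          (Finset.sum_nonneg fun i (_ : i ∈ Finset.univ) => hC0 i)
        linarith [Real.sqrt_nonneg (T : ℝ)]

end MSPSA

end

theorem mainTheorem6 (K n : ℕ) (Θ : Set (Params K n)) (hΘ : IsCompact Θ)
    (D : Set (Vec n)) (hD : IsCompact D) (hDconv : Convex ℝ D)
    (σw ξ₁ ξ₂ : ℝ) (hσw : 0 < σw) (hξ₁ : 0 < ξ₁) (hξ₂ : 0 < ξ₂)
    (p : MSPSA K n) (hp : p.Valid D ξ₁ ξ₂) :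
    (∀ I : Model K n, I.Admissible Θ D σw → ∀ (R : Realization I p.ν) (T : ℕ),
      Integrable (R.costGap D T) R.μ) ∧
    ∃ C > (0 : ℝ), ∃ C' > (0 : ℝ), ∀ T : ℕ,
      p.worstInputMSE D {I | I.Admissible Θ D σw ∧ p.StepCondition I} T
        ≤ ENNReal.ofReal (C * Real.sqrt T) ∧
      p.worstRegret D {I | I.Admissible Θ D σw ∧ p.StepCondition I} T
        ≤ ((C' * Real.sqrt T : ℝ) : EReal) := by
  obtain ⟨M, hM, hMΘ⟩ := exists_norm_params_le hΘ
  refine ⟨fun I h R T => R.integrable_costGap hp hD hDconv h hM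
    (fun j => (hMΘ _ h.θ_mem j).1) T, ?_⟩
  obtain ⟨C, hC, hmse⟩ := hp.exists_inputMSE_le hξ₂.le hD hDconv σw hM hMΘ
  -- The regret constant is `M * C`; `M + 1` ensures positivity when `M = 0`.
  refine ⟨C, hC, (M + 1) * C, by positivity, fun T => ⟨?_, ?_⟩⟩
  · exact iSup₂_le fun I hI => iSup_le fun R => hmse I hI.1 hI.2 R T
  · refine iSup₂_le fun I hI => iSup_le fun R => EReal.coe_le_coe_iff.2 ?_
    have h1 := R.regret_le hp hD hDconv hI.1 hM (fun j => (hMΘ _ hI.1.θ_mem j).1)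
      (by positivity) (hmse I hI.1 hI.2 R T)
    have h2 : 0 ≤ C * √(T : ℝ) := by positivity
    linarith
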